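/- Let $(Y,\boldsymbol X)$ be a random pair with values in $\mathbb R\times\mathbb R^p$ ($p$ fixed), and let $\mathcal L(y,z)$ be a loss that is measurable in $y$; primes denote derivatives with respect to $z$. Assume: (C1) for every $y$, $z\mapsto\mathcal L(y,z)$ is convex and its third-order derivative exists and is differentiable. Let $\boldsymbol\beta^*\in\mathbb R^p$ be a minimizer of $\boldsymbol\beta\mapsto \mathbb E\{\mathcal L(Y,\boldsymbol X^\top\boldsymbol\beta)\}$ (finite at $\boldsymbol\beta^*$), and let $\mathcal A=\{k:\beta^*_k\ne0\}$. Assume further: (C2) there are an open set $\mathcal O\ni\boldsymbol\beta^*$ and a function $g$ such that, almost surely, $|\mathcal L'''(Y,\boldsymbol X^\top\boldsymbol\beta)|\le g(\boldsymbol X)<\infty$ for all $\boldsymbol\beta\in\mathcal O$, and $\mathbb E\{g(\boldsymbol X)|X_jX_kX_l|\}<\infty$ for all $1\le j,k,l\le p$; and that the matrices $$\boldsymbol\Phi=\mathbb E\{\mathcal L'(Y,\boldsymbol X^\top\boldsymbol\beta^*)^2\boldsymbol X\boldsymbol X^\top\},\qquad \boldsymbol\Psi=\mathbb E\{\mathcal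 L''(Y,\boldsymbol X^\top\boldsymbol\beta^*)\boldsymbol X\boldsymbol X^\top\}$$ are finite, with $\boldsymbol\Psi_{\mathcal A}$ invertible, where $\boldsymbol M_{\mathcal A}$ denotes the submatrix of $\boldsymbol M$ with rows and columns in $\mathcal A$. Let $(Y_i,\boldsymbol X_i)$, $i=1,2,\dots$, be independent copies of $(Y,\boldsymbol X)$. Worker $j$ holds the samples with indices in a finite set $\mathcal I_j$ of size $n_j$ (depending on the stage of the asymptotics), with $n_j\to\infty$. Let $\xi>0$, let $\widehat{\boldsymbol\beta}^{\mathrm{pre}}$ be a pre-estimate with $\sqrt{n_j}(\widehat{\boldsymbol\beta}^{\mathrm{pre}}-\boldsymbol\beta^*)=O_p(1)$, and put $\hat\omega_k=1/|\hat\beta^{\mathrm{pre}}_k|^{\xi}$ (with $\hat\omega_k=\infty$ if $\hat\beta^{\mathrm{pre}}_k=0$, and $\infty\cdot 0=0$). Let $\widehat{\boldsymbol\beta}_j$ be the local adaptive-lasso estimator with tuning parameter $\lambda_{nj}\ge0$: a random vector that, with probability tending to $1$ (for instance always), minimizes over $\boldsymbol\beta\in\mathbb R^p$ $$\sum_{i\in\mathcal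 I_j}\mathcal L(Y_i,\boldsymbol X_i^\top\boldsymbol\beta)+\lambda_{nj}\sum_{k=1}^p\hat\omega_k|\beta_k| .$$ Let $\widehat{\mathcal A}_j=\{k:\hat\beta_{jk}\neq0\}$, and let $\widehat{\boldsymbol\beta}_{\mathcal A,j}$ and $\boldsymbol\beta^*_{\mathcal A}$ be the sub-vectors of $\widehat{\boldsymbol\beta}_j$ and $\boldsymbol\beta^*$ with coordinates in $\mathcal A$. If $\lambda_{nj}/\sqrt{n_j}\to0$ and $\lambda_{nj}\,n_j^{(\xi-1)/2}\to\infty$, then 1. (Selection consistency) $P(\widehat{\mathcal A}_j=\mathcal A)\to1$; 2. (Asymptotic normality) $\sqrt{n_j}\,(\widehat{\boldsymbol\beta}_{\mathcal A,j}-\boldsymbol\beta^*_{\mathcal A})\to_d N(\boldsymbol 0,\ \boldsymbol\Psi_{\mathcal A}^{-1}\boldsymbol\Phi_{\mathcal A}\boldsymbol\Psi_{\mathcal A}^{-1})$. -/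

import Mathlib

open MeasureTheory ProbabilityTheory Filter Topology
open scoped ENNReal

noncomputable section

namespace AdaptiveLasso

variable {p : ℕ}

/-- The support of a coefficient vector: the set of coordinates with a nonzero entry. -/
def supp (b : EuclideanSpace ℝ (Fin p)) : Finset (Fin p) :=
  Finset.univ.filter fun k => b k ≠ 0

/-- The sub-vector of `b` with coordinates in `A`. -/
def subvec (A : Finset (Fin p)) (b : EuclideanSpace ℝ (Fin p)) : EuclideanSpace ℝ A :=
  WithLp.toLp 2 fun k => b k

/-- The submatrix of `M` with rows and columns in `A`. -/
def submat (A : Finset (Fin p)) (M : Matrix (Fin p) (Fin p) ℝ) : Matrix A A ℝ :=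
  M.submatrix (fun k => (k : Fin p)) (fun k => (k : Fin p))

/-- The population loss minimization: `b` is a minimizer over `ℝ^p` of the expected loss
`β ↦ E L(Y, Xᵀβ)`, where `P` is the joint law of `(Y, X)`. The expected loss is finite at `b`; a
vector at which the loss is not integrable does not compete (its expected loss is `+∞`). -/
def IsPopulationMinimizer (L : ℝ → ℝ → ℝ) (P : Measure (ℝ × EuclideanSpace ℝ (Fin p)))
    (b : EuclideanSpace ℝ (Fin p)) : Prop :=
  Integrable (fun z => L z.1 (inner ℝ z.2 b)) P ∧
    ∀ b' : EuclideanSpace ℝ (Fin p), Integrable (fun z => L z.1 (inner ℝ z.2 b')) P →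
      ∫ z, L z.1 (inner ℝ z.2 b) ∂P ≤ ∫ z, L z.1 (inner ℝ z.2 b') ∂P

/-- The integrand of the entry `(k, l)` of `Φ`. -/
def phiIntegrand (L : ℝ → ℝ → ℝ) (b : EuclideanSpace ℝ (Fin p)) (k l : Fin p)
    (z : ℝ × EuclideanSpace ℝ (Fin p)) : ℝ :=
  (deriv (L z.1) (inner ℝ z.2 b)) ^ 2 * (z.2 k * z.2 l)

/-- The integrand of the entry `(k, l)` of `Ψ`. -/
def psiIntegrand (L : ℝ → ℝ → ℝ) (b : EuclideanSpace ℝ (Fin p)) (k l : Fin p)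
    (z : ℝ × EuclideanSpace ℝ (Fin p)) : ℝ :=
  iteratedDeriv 2 (L z.1) (inner ℝ z.2 b) * (z.2 k * z.2 l)

/-- `Φ = E (L'(Y, Xᵀb)² X Xᵀ)`. -/
def Phi (L : ℝ → ℝ → ℝ) (P : Measure (ℝ × EuclideanSpace ℝ (Fin p)))
    (b : EuclideanSpace ℝ (Fin p)) : Matrix (Fin p) (Fin p) ℝ :=
  Matrix.of fun k l => ∫ z, phiIntegrand L b k l z ∂P

/-- `Ψ = E (L''(Y, Xᵀb) X Xᵀ)`. -/
def Psi (L : ℝ → ℝ → ℝ) (P : Measure (ℝ × EuclideanSpace ℝ (Fin p)))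
    (b : EuclideanSpace ℝ (Fin p)) : Matrix (Fin p) (Fin p) ℝ :=
  Matrix.of fun k l => ∫ z, psiIntegrand L b k l z ∂P

/-- Convexity and smoothness of the loss: for every value `y` of the response, `z ↦ L(y, z)` is
convex and has a third-order derivative, which is differentiable. -/
def ConvexSmoothLoss (L : ℝ → ℝ → ℝ) : Prop :=
  ∀ y, ConvexOn ℝ Set.univ (L y) ∧ ContDiff ℝ 3 (L y) ∧ Differentiable ℝ (iteratedDeriv 3 (L y))

/-- Local domination of the third derivative: on an open set around `b`, the third derivative of
the loss is bounded by a function `g` of `X` such that `E (g(X) |X_j X_k X_l|) < ∞` for all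
`j, k, l`. -/
def ThirdDerivDominated (L : ℝ → ℝ → ℝ) (P : Measure (ℝ × EuclideanSpace ℝ (Fin p)))
    (b : EuclideanSpace ℝ (Fin p)) : Prop :=
  ∃ (O : Set (EuclideanSpace ℝ (Fin p))) (g : EuclideanSpace ℝ (Fin p) → ℝ),
    IsOpen O ∧ b ∈ O ∧
    (∀ᵐ z ∂P, ∀ b' ∈ O, |iteratedDeriv 3 (L z.1) (inner ℝ z.2 b')| ≤ g z.2) ∧
    ∀ j k l : Fin p, Integrable (fun z => g z.2 * |z.2 j * z.2 k * z.2 l|) P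

/-- The adaptive weight `1 / |b|^ξ`, which is `∞` when the pre-estimate `b` vanishes. -/
def weight (ξ b : ℝ) : ℝ≥0∞ := (ENNReal.ofReal (|b| ^ ξ))⁻¹

/-- The adaptive `L₁` penalty `lam * ∑_k ω_k |β_k|` with weights from the pre-estimate `pre`.
An infinite weight contributes `0` if `β_k = 0` and `∞` otherwise. -/
def penalty (lam ξ : ℝ) (pre b : EuclideanSpace ℝ (Fin p)) : ℝ≥0∞ :=
  ENNReal.ofReal lam * ∑ k, weight ξ (pre k) * ENNReal.ofReal |b k|

/-- The adaptive lasso criterion `∑_{i ∈ I} L(y_i, x_iᵀβ) + lam * ∑_k ω_k |β_k|` on the samples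
with indices in `I`. -/
def criterion (L : ℝ → ℝ → ℝ) (I : Finset ℕ) (y : ℕ → ℝ) (x : ℕ → EuclideanSpace ℝ (Fin p))
    (lam ξ : ℝ) (pre b : EuclideanSpace ℝ (Fin p)) : EReal :=
  ((∑ i ∈ I, L (y i) (inner ℝ (x i) b) : ℝ) : EReal) + ((penalty lam ξ pre b : ℝ≥0∞) : EReal)

/-- `b` is an adaptive lasso estimate: a global minimizer of the criterion. -/
def IsAdaptiveLasso (L : ℝ → ℝ → ℝ) (I : Finset ℕ) (y : ℕ → ℝ)
    (x : ℕ → EuclideanSpace ℝ (Fin p)) (lam ξ : ℝ) (pre b : EuclideanSpace ℝ (Fin p)) : Prop :=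
  ∀ b', criterion L I y x lam ξ pre b ≤ criterion L I y x lam ξ pre b'

/-- `Z t = O_p(1)` as `t → ∞`: stochastic boundedness. -/
def BoundedInProbability {Ω : Type*} [MeasurableSpace Ω] (μ : Measure Ω)
    (Z : ℕ → Ω → EuclideanSpace ℝ (Fin p)) : Prop :=
  ∀ ε : ℝ≥0∞, 0 < ε → ∃ M : ℝ, ∀ᶠ t in atTop, μ {ω | M < ‖Z t ω‖} ≤ ε

end AdaptiveLasso

end

/-! Write `s` for the square root of the sample size and `u = s (β - β*)` for the local parameter.
In local coordinates the empirical loss is convex and, uniformly on balls, equals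
`⟪W, u⟫ + uᵀ Ψ u / 2` up to an error that vanishes in probability, where `W` is the normalized score:
this is a Taylor expansion with a cubic remainder (`abs_localLoss_sub_le`) and the law of large
numbers (`tendsto_measure_sampleMean_sub`). The score has mean zero because `β*` minimizes the
expected loss (`integral_inner_score_eq_zero`), hence `W` obeys the central limit theorem
(`tendstoInDistribution_inv_sqrt_smul_sum`) and is stochastically bounded.

The rates of the tuning parameter make the penalty negligible on the true support `A` and, off `A`,
larger than any fixed multiple of `‖u - π u‖`, where `π` is the coordinate projection onto `A`.
A convex function that is bounded on a ball is Lipschitz on a smaller one, so the penalty off `A`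
beats the loss and forces `u = π u` exactly, while on `A` the quadratic growth of `Ψ_A` pins `u` down
to within `o_p(1)` of the minimizer `-Ψ_A⁻¹ W_A` of the limiting quadratic
(`norm_sub_lt_and_proj_eq_of_penalized_min`). Convexity makes a comparison on a small sphere around
that minimizer sufficient, so no consistency of the estimator has to be known beforehand, and only
`Ψ_A` has to be invertible. The deterministic part is `localization_of_good_sample`; the
samples it covers have probability close to one (`eventually_measure_not_localized_le`). Selection
consistency follows, and asymptotic normality is the central limit theorem for the influence
function `-Ψ_A⁻¹ L'(y, xᵀβ*) x_A` with Slutsky's lemma. -/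

/-! ### Calculus and measurability of the loss -/

namespace AdaptiveLasso

variable {p : ℕ}

lemma abs_sub_taylor_two_le {f : ℝ → ℝ} (hf : ContDiff ℝ 3 f) {a h K : ℝ}
    (hK : ∀ x ∈ Set.uIcc a (a + h), |iteratedDeriv 3 f x| ≤ K) :
    |f (a + h) - f a - deriv f a * h - iteratedDeriv 2 f a * h ^ 2 / 2| ≤ K * |h| ^ 3 / 6 := by
  rcases eq_or_ne h 0 with rfl | hh
  · simp
  have hne : a ≠ a + h := by simpa using hh
  have hu : UniqueDiffOn ℝ (Set.uIcc a (a + h)) := uniqueDiffOn_uIcc hne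
  have hcd : ContDiffOn ℝ ((2 : ℕ) + 1) f (Set.uIcc a (a + h)) :=
    (hf.of_le (by norm_num)).contDiffOn
  obtain ⟨x, hx, hxe⟩ := taylor_mean_remainder_lagrange_iteratedDeriv hne hcd
  have ha : a ∈ Set.uIcc a (a + h) := Set.left_mem_uIcc
  have h2 : iteratedDerivWithin 2 f (Set.uIcc a (a + h)) a = iteratedDeriv 2 f a := by
    rw [iteratedDerivWithin_eq_iteratedDeriv hu (hf.of_le (by norm_num)).contDiffAt ha]
  have h1 : iteratedDerivWithin 1 f (Set.uIcc a (a + h)) a = deriv f a := by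
    rw [iteratedDerivWithin_eq_iteratedDeriv hu (hf.of_le (by norm_num)).contDiffAt ha,
      iteratedDeriv_one]
  rw [taylorWithinEval_succ, taylorWithinEval_succ, taylor_within_zero_eval] at hxe
  simp only [h1, h2, zero_add, one_add_one_eq_two] at hxe
  have key : f (a + h) - f a - deriv f a * h - iteratedDeriv 2 f a * h ^ 2 / 2
      = iteratedDeriv 3 f x * h ^ 3 / 6 := by
    have : ((2 + 1).factorial : ℝ) = 6 := by norm_num [Nat.factorial]
    rw [this] at hxe
    norm_num [Nat.factorial] at hxe
    linarith
  rw [key, abs_div, abs_mul, abs_pow, abs_of_pos (by norm_num : (0 : ℝ) < 6)]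
  gcongr
  exact hK x (Set.uIoo_subset_uIcc_self hx)

/-- The derivative in the second variable of a function that is measurable in the first one is
again measurable in the first one, as a limit of difference quotients. -/
lemma measurable_deriv_section {F : ℝ → ℝ → ℝ} (hF : ∀ z, Measurable fun y => F y z)
    (hd : ∀ y, Differentiable ℝ (F y)) (z : ℝ) : Measurable fun y => deriv (F y) z := by
  refine measurable_of_tendsto_metrizable
    (f := fun (n : ℕ) y => ((n : ℝ) + 1) * (F y (z + 1 / ((n : ℝ) + 1)) - F y z)) ?_ ?_
  · intro n
    exact ((hF _).sub (hF _)).const_mul _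
  · rw [tendsto_pi_nhds]
    intro y
    have h := (hd y z).hasDerivAt.tendsto_slope_zero
    have h0 : Tendsto (fun n : ℕ => 1 / ((n : ℝ) + 1)) atTop (𝓝[≠] 0) := by
      refine tendsto_nhdsWithin_iff.2 ⟨tendsto_one_div_add_atTop_nhds_zero_nat, ?_⟩
      exact Eventually.of_forall fun n => by
        simp only [Set.mem_compl_iff, Set.mem_singleton_iff]
        positivity
    refine (h.comp h0).congr fun n => ?_
    simp

lemma measurable_comp_inner {F : ℝ → ℝ → ℝ} (hF : ∀ z, Measurable fun y => F y z)
    (hc : ∀ y, Continuous (F y)) (b : EuclideanSpace ℝ (Fin p)) :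
    Measurable fun z : ℝ × EuclideanSpace ℝ (Fin p) => F z.1 (inner ℝ z.2 b) := by
  have h : Measurable (Function.uncurry fun (z y : ℝ) => F y z) :=
    measurable_uncurry_of_continuous_of_measurable (u := fun (z y : ℝ) => F y z) hc hF
  have h2 : Measurable fun z : ℝ × EuclideanSpace ℝ (Fin p) => ((inner ℝ z.2 b : ℝ), z.1) := by
    fun_prop
  exact h.comp h2

lemma measurable_loss {L : ℝ → ℝ → ℝ} (hLmeas : ∀ z, Measurable fun y => L y z)
    (hC1 : ConvexSmoothLoss L) (b : EuclideanSpace ℝ (Fin p)) :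
    Measurable fun z : ℝ × EuclideanSpace ℝ (Fin p) => L z.1 (inner ℝ z.2 b) :=
  measurable_comp_inner hLmeas (fun y => (hC1 y).2.1.continuous) b

/-- The score `L'(y, xᵀb) x` of a single observation. -/
noncomputable def score (L : ℝ → ℝ → ℝ) (b : EuclideanSpace ℝ (Fin p))
    (z : ℝ × EuclideanSpace ℝ (Fin p)) : EuclideanSpace ℝ (Fin p) :=
  deriv (L z.1) (inner ℝ z.2 b) • z.2

lemma measurable_score {L : ℝ → ℝ → ℝ} (hLmeas : ∀ z, Measurable fun y => L y z)
    (hC1 : ConvexSmoothLoss L) (b : EuclideanSpace ℝ (Fin p)) : Measurable (score L b) := by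
  have h : Measurable fun z : ℝ × EuclideanSpace ℝ (Fin p) =>
      deriv (L z.1) (inner ℝ z.2 b) :=
    measurable_comp_inner (F := fun y => deriv (L y))
      (measurable_deriv_section hLmeas fun y => (hC1 y).2.1.differentiable (by norm_num))
      (fun y => (hC1 y).2.1.continuous_deriv (by norm_num)) b
  exact h.smul measurable_snd

lemma iteratedDeriv_two_nonneg {f : ℝ → ℝ} (hf : ConvexOn ℝ Set.univ f) (hd : ContDiff ℝ 3 f)
    (x : ℝ) : 0 ≤ iteratedDeriv 2 f x := by
  have hmono : Monotone (deriv f) := by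
    have := hf.monotoneOn_deriv (fun x _ => (hd.differentiable (by norm_num)) x)
    exact monotoneOn_univ.1 this
  rw [iteratedDeriv_succ, iteratedDeriv_one]
  exact hmono.deriv_nonneg

/-- The quadratic form of a matrix. -/
noncomputable def quadForm (M : Matrix (Fin p) (Fin p) ℝ) (u : EuclideanSpace ℝ (Fin p)) : ℝ :=
  ∑ k, ∑ l, M k l * (u k * u l)

lemma inner_eq_sum (u v : EuclideanSpace ℝ (Fin p)) : inner ℝ u v = ∑ k, u k * v k := by
  simp [PiLp.inner_apply, mul_comm]

lemma abs_apply_le_norm (u : EuclideanSpace ℝ (Fin p)) (k : Fin p) : |u k| ≤ ‖u‖ := by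
  simpa using PiLp.norm_apply_le u k

lemma quadForm_psi (L : ℝ → ℝ → ℝ) (b : EuclideanSpace ℝ (Fin p))
    (z : ℝ × EuclideanSpace ℝ (Fin p)) (u : EuclideanSpace ℝ (Fin p)) :
    quadForm (Matrix.of fun k l => psiIntegrand L b k l z) u =
      iteratedDeriv 2 (L z.1) (inner ℝ z.2 b) * (inner ℝ z.2 u) ^ 2 := by
  rw [inner_eq_sum z.2 u, sq, Finset.sum_mul_sum, Finset.mul_sum, quadForm]
  refine Finset.sum_congr rfl fun k _ => ?_
  rw [Finset.mul_sum]
  refine Finset.sum_congr rfl fun l _ => ?_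
  simp only [psiIntegrand, Matrix.of_apply]
  ring

lemma abs_quadForm_sub_le (M N : Matrix (Fin p) (Fin p) ℝ) (u : EuclideanSpace ℝ (Fin p)) :
    |quadForm M u - quadForm N u| ≤ (∑ k, ∑ l, |M k l - N k l|) * ‖u‖ ^ 2 := by
  simp only [quadForm, ← Finset.sum_sub_distrib, ← sub_mul, Finset.sum_mul]
  refine (Finset.abs_sum_le_sum_abs _ _).trans (Finset.sum_le_sum fun k _ => ?_)
  refine (Finset.abs_sum_le_sum_abs _ _).trans (Finset.sum_le_sum fun l _ => ?_)
  rw [abs_mul, abs_mul, sq]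
  gcongr <;> exact abs_apply_le_norm _ _

/-- The envelope `∑ g(x) |x_j x_k x_l|` of the cubic Taylor remainder of one observation. -/
noncomputable def cubicEnvelope (g : EuclideanSpace ℝ (Fin p) → ℝ)
    (z : ℝ × EuclideanSpace ℝ (Fin p)) : ℝ :=
  ∑ j, ∑ k, ∑ l, g z.2 * |z.2 j * z.2 k * z.2 l|

lemma abs_inner_pow_three_le (x u : EuclideanSpace ℝ (Fin p)) :
    |inner ℝ x u| ^ 3 ≤ (∑ j, ∑ k, ∑ l, |x j * x k * x l|) * ‖u‖ ^ 3 := by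
  have h1 : |inner ℝ x u| ≤ (∑ j, |x j|) * ‖u‖ := by
    rw [inner_eq_sum, Finset.sum_mul]
    refine (Finset.abs_sum_le_sum_abs _ _).trans (Finset.sum_le_sum fun k _ => ?_)
    rw [abs_mul]
    gcongr
    exact abs_apply_le_norm _ _
  have h2 : (∑ j, ∑ k, ∑ l, |x j * x k * x l|) = (∑ j, |x j|) ^ 3 := by
    rw [pow_succ, sq, Finset.sum_mul_sum, Finset.sum_mul]
    refine Finset.sum_congr rfl fun j _ => ?_
    rw [Finset.sum_mul_sum]
    refine Finset.sum_congr rfl fun k _ => ?_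
    refine Finset.sum_congr rfl fun l _ => ?_
    rw [abs_mul, abs_mul]
  rw [h2, ← mul_pow]
  gcongr

/-- Second-order expansion of the loss of a single observation around `b`, with a cubic
remainder that is uniform over a ball. -/
lemma abs_loss_expansion_le {L : ℝ → ℝ → ℝ} (hC1 : ConvexSmoothLoss L)
    {b : EuclideanSpace ℝ (Fin p)} {g : EuclideanSpace ℝ (Fin p) → ℝ} {ρ : ℝ}
    {z : ℝ × EuclideanSpace ℝ (Fin p)}
    (hz : ∀ b' ∈ Metric.ball b ρ, |iteratedDeriv 3 (L z.1) (inner ℝ z.2 b')| ≤ g z.2)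
    {u : EuclideanSpace ℝ (Fin p)} (hu : ‖u‖ < ρ) :
    |L z.1 (inner ℝ z.2 (b + u)) - L z.1 (inner ℝ z.2 b) - inner ℝ (score L b z) u
        - quadForm (Matrix.of fun k l => psiIntegrand L b k l z) u / 2|
      ≤ cubicEnvelope g z * ‖u‖ ^ 3 / 6 := by
  have hK : ∀ x ∈ Set.uIcc (inner ℝ z.2 b : ℝ) (inner ℝ z.2 b + inner ℝ z.2 u),
      |iteratedDeriv 3 (L z.1) x| ≤ g z.2 := by
    intro x hx
    rw [← segment_eq_uIcc, segment_eq_image'] at hx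
    obtain ⟨θ, hθ, rfl⟩ := hx
    have := hz (b + θ • u) (by
      rw [Metric.mem_ball, dist_eq_norm, add_sub_cancel_left, norm_smul, Real.norm_eq_abs,
        abs_of_nonneg hθ.1]
      exact (mul_le_of_le_one_left (norm_nonneg _) hθ.2).trans_lt hu)
    simpa [inner_add_right, inner_smul_right] using this
  have hT := abs_sub_taylor_two_le (hC1 z.1).2.1 hK
  have hg : 0 ≤ g z.2 := (abs_nonneg _).trans (hK _ Set.left_mem_uIcc)
  rw [quadForm_psi, inner_add_right, score, real_inner_smul_left]
  refine hT.trans ?_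
  have h3 := abs_inner_pow_three_le z.2 u
  have h4 : cubicEnvelope g z = g z.2 * ∑ j, ∑ k, ∑ l, |z.2 j * z.2 k * z.2 l| := by
    simp only [cubicEnvelope, Finset.mul_sum]
  rw [h4, mul_assoc]
  gcongr

end AdaptiveLasso

/-! ### Localization of minimizers of penalized convex functions -/

namespace AdaptiveLasso

section Localization

variable {E : Type*} [NormedAddCommGroup E] [NormedSpace ℝ E]

/-- A convex function bounded by `M` on a ball is `2M`-Lipschitz on the ball of radius smaller by
one; only the lower estimate is needed. -/
lemma sub_le_of_convexOn_of_abs_le {S : E → ℝ} (hS : ConvexOn ℝ Set.univ S) {M R : ℝ}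
    (hM : ∀ v, ‖v‖ ≤ R + 1 → |S v| ≤ M) {v w : E} (hv : ‖v‖ ≤ R) :
    S v - S w ≤ 2 * M * ‖w - v‖ := by
  rcases eq_or_ne w v with rfl | hne
  · simp
  set r := ‖w - v‖ with hr
  have hr0 : 0 < r := norm_pos_iff.2 (sub_ne_zero.2 hne)
  -- `v` is a convex combination of `w` and of the point at distance `1` on the opposite side
  set x := v - r⁻¹ • (w - v) with hx
  have hxn : ‖x‖ ≤ R + 1 := by
    refine (norm_sub_le _ _).trans ?_
    rw [norm_smul, norm_inv, norm_norm, ← hr, inv_mul_cancel₀ hr0.ne']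
    linarith
  have hcomb : (r / (1 + r)) • x + (1 / (1 + r)) • w = v := by
    rw [hx]
    have h1 : (1 + r) ≠ 0 := by positivity
    have : w = v + (w - v) := by abel
    rw [this]
    generalize w - v = e
    simp only [smul_sub, smul_add, smul_smul, add_sub_cancel_left]
    have e1 : r / (1 + r) * r⁻¹ = 1 / (1 + r) := by field_simp
    rw [e1]
    have e2 : (r / (1 + r)) • v + (1 / (1 + r)) • v = v := by
      rw [← add_smul, ← add_div, add_comm r 1, div_self h1, one_smul]
    nth_rw 3 [← e2]
    abel
  have hconv := hS.2 (Set.mem_univ x) (Set.mem_univ w) (by positivity : 0 ≤ r / (1 + r))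
    (by positivity : 0 ≤ 1 / (1 + r)) (by field_simp; ring)
  rw [hcomb, smul_eq_mul, smul_eq_mul] at hconv
  have hxM := (abs_le.1 (hM x hxn)).2
  have hvM := (abs_le.1 (hM v (by linarith))).1
  have h2 : S v * (1 + r) ≤ r * S x + S w := by
    have := mul_le_mul_of_nonneg_right hconv (by positivity : (0 : ℝ) ≤ 1 + r)
    calc S v * (1 + r) ≤ _ := this
      _ = r * S x + S w := by field_simp
  nlinarith

/-- Localization of a penalized minimizer. Here `π` is a projection, `S` is a convex function and
`T` a convex function of `π v`. If `û` beats every `u'` in the range of `π` even after paying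
`C ‖û - π û‖`, with `C` beyond the Lipschitz constant of `S`, and if on the range of `π` the
function `S + T` grows quadratically around `ũ` up to an error `δ`, then `û` lies in the range of
`π`, close to `ũ`. -/
lemma norm_sub_lt_and_proj_eq_of_penalized_min {S T : E → ℝ} (hS : ConvexOn ℝ Set.univ S)
    (hT : ConvexOn ℝ Set.univ T) (π : E →ₗ[ℝ] E) (hππ : ∀ v, π (π v) = π v)
    (hπ : ∀ v, ‖π v‖ ≤ ‖v‖) (hTπ : ∀ v, T (π v) = T v)
    {M R C κ δ ε : ℝ} {uhat util : E}
    (hM : ∀ v, ‖v‖ ≤ R + 1 → |S v| ≤ M) (hC : 2 * M + 1 ≤ C) (hutil : π util = util)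
    (hR : ‖util‖ + 1 ≤ R)
    (hmin : ∀ u', π u' = u' → S uhat + T uhat + C * ‖uhat - π uhat‖ ≤ S u' + T u')
    (hgrow : ∀ v, π v = v → ‖v‖ ≤ R → κ * ‖v - util‖ ^ 2 - δ ≤ S v + T v - (S util + T util))
    (hε : 0 < ε) (hε1 : ε ≤ 1) (hκ : 0 < κ) (hδ1 : δ < κ * ε ^ 2 / 4) (hδ2 : δ < ε / 2) :
    ‖uhat - util‖ < ε ∧ π uhat = uhat := by
  have hM0 : 0 ≤ M := (abs_nonneg _).trans (hM util (by linarith))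
  set D : E → ℝ := fun v => S v + T v + C * ‖v - π v‖ with hD
  have hDconv : ConvexOn ℝ Set.univ D := by
    refine (hS.add hT).add (ConvexOn.smul (by linarith) ?_)
    have := (convexOn_univ_norm (E := E)).comp_linearMap (LinearMap.id - π)
    exact this
  have hDutil : D util = S util + T util := by simp [hD, hutil]
  have hDhat : D uhat ≤ D util := by rw [hDutil]; exact hmin util hutil
  have hlow : ∀ v, ‖v‖ ≤ R → S (π v) + T (π v) + ‖v - π v‖ ≤ D v := by
    intro v hv
    have h1 := sub_le_of_convexOn_of_abs_le hS hM (w := v) ((hπ v).trans hv)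
    have h2 : (2 * M + 1) * ‖v - π v‖ ≤ C * ‖v - π v‖ := by gcongr
    simp only [hD, hTπ]
    linarith
  have hsphere : ∀ v, ‖v - util‖ = ε → D util < D v := by
    intro v hv
    have hvR : ‖v‖ ≤ R := by
      have := norm_add_le (v - util) util
      rw [sub_add_cancel] at this
      linarith
    have h1 := hlow v hvR
    have h2 := hgrow (π v) (hππ v) ((hπ v).trans hvR)
    have h3 : ε ≤ ‖π v - util‖ + ‖v - π v‖ := by
      rw [← hv]
      calc ‖v - util‖ = ‖(π v - util) + (v - π v)‖ := by congr 1; abel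
        _ ≤ _ := norm_add_le _ _
    rw [hDutil]
    -- either the active or the inactive part of `v - ũ` has length at least `ε / 2`
    rcases le_or_gt (ε / 2) ‖π v - util‖ with h | h
    · have : κ * (ε / 2) ^ 2 ≤ κ * ‖π v - util‖ ^ 2 := by gcongr
      have h5 := norm_nonneg (v - π v)
      nlinarith
    · have : 0 ≤ κ * ‖π v - util‖ ^ 2 := by positivity
      linarith
  have hclose : ‖uhat - util‖ < ε := by
    -- otherwise the segment from `ũ` to `û` meets the sphere at a point with `D v ≤ D ũ`
    by_contra! hcon
    have hpos : 0 < ‖uhat - util‖ := hε.trans_le hcon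
    set θ := ε / ‖uhat - util‖ with hθ
    have hθ0 : 0 ≤ θ := by positivity
    have hθ1 : θ ≤ 1 := (div_le_one hpos).2 hcon
    set v := (1 - θ) • util + θ • uhat with hv
    have hvs : ‖v - util‖ = ε := by
      have : v - util = θ • (uhat - util) := by rw [hv]; module
      rw [this, norm_smul, Real.norm_eq_abs, abs_of_nonneg hθ0, hθ, div_mul_cancel₀ _ hpos.ne']
    have hc := hDconv.2 (Set.mem_univ util) (Set.mem_univ uhat) (sub_nonneg.2 hθ1) hθ0
      (sub_add_cancel 1 θ)
    rw [smul_eq_mul, smul_eq_mul, ← hv] at hc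
    have := hsphere v hvs
    nlinarith
  refine ⟨hclose, ?_⟩
  have hvR : ‖uhat‖ ≤ R := by
    have := norm_add_le (uhat - util) util
    rw [sub_add_cancel] at this
    linarith
  -- comparing `û` with its own projection `π û`
  have h1 := hlow uhat hvR
  have h2 := hmin (π uhat) (hππ uhat)
  have h3 : ‖uhat - π uhat‖ = 0 := le_antisymm (by simp only [hD] at h1; linarith) (norm_nonneg _)
  exact (sub_eq_zero.1 (norm_eq_zero.1 h3)).symm

end Localization

variable {p : ℕ}

/-- The coordinate projection that keeps the coordinates in `A` and sets the others to zero. -/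
noncomputable def coordProj (A : Finset (Fin p)) :
    EuclideanSpace ℝ (Fin p) →ₗ[ℝ] EuclideanSpace ℝ (Fin p) where
  toFun u := WithLp.toLp 2 fun k => if k ∈ A then u k else 0
  map_add' u v := by ext k; by_cases h : k ∈ A <;> simp [h]
  map_smul' c u := by ext k; by_cases h : k ∈ A <;> simp [h]

lemma coordProj_apply (A : Finset (Fin p)) (u : EuclideanSpace ℝ (Fin p)) (k : Fin p) :
    coordProj A u k = if k ∈ A then u k else 0 := rfl

lemma coordProj_coordProj (A : Finset (Fin p)) (u : EuclideanSpace ℝ (Fin p)) :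
    coordProj A (coordProj A u) = coordProj A u := by
  ext k; by_cases h : k ∈ A <;> simp [coordProj_apply, h]

lemma norm_coordProj_le (A : Finset (Fin p)) (u : EuclideanSpace ℝ (Fin p)) :
    ‖coordProj A u‖ ≤ ‖u‖ := by
  rw [EuclideanSpace.norm_eq, EuclideanSpace.norm_eq]
  refine Real.sqrt_le_sqrt (Finset.sum_le_sum fun k _ => ?_)
  by_cases h : k ∈ A <;> simp [coordProj_apply, h, sq_nonneg]

lemma coordProj_eq_self_iff (A : Finset (Fin p)) (u : EuclideanSpace ℝ (Fin p)) :
    coordProj A u = u ↔ ∀ k ∉ A, u k = 0 := by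
  constructor
  · intro h k hk
    rw [← h, coordProj_apply, if_neg hk]
  · intro h
    ext k
    by_cases hk : k ∈ A <;> simp [coordProj_apply, hk, h]

lemma norm_sub_coordProj_le (A : Finset (Fin p)) (u : EuclideanSpace ℝ (Fin p)) :
    ‖u - coordProj A u‖ ≤ ∑ k ∈ Aᶜ, |u k| := by
  have h : u - coordProj A u = ∑ k ∈ Aᶜ, EuclideanSpace.single k (u k) := by
    ext l
    simp only [PiLp.sub_apply, coordProj_apply, WithLp.ofLp_sum, Finset.sum_apply,
      PiLp.single_apply]
    by_cases hl : l ∈ A <;> simp [hl]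
  rw [h]
  refine (norm_sum_le _ _).trans (Finset.sum_le_sum fun k _ => ?_)
  simp

/-! ### The adaptive penalty in local coordinates -/

/-- The part of the penalty that is carried by the coordinates in `A`, as a function of the local
parameter `u = s (β - b)`, where `s` is the square root of the sample size. -/
noncomputable def activePenalty (A : Finset (Fin p)) (lam ξ s : ℝ)
    (pre b u : EuclideanSpace ℝ (Fin p)) : ℝ :=
  lam * ∑ k ∈ A, (|pre k| ^ ξ)⁻¹ * |b k + u k / s|

lemma activePenalty_coordProj (A : Finset (Fin p)) (lam ξ s : ℝ)
    (pre b u : EuclideanSpace ℝ (Fin p)) :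
    activePenalty A lam ξ s pre b (coordProj A u) = activePenalty A lam ξ s pre b u := by
  unfold activePenalty
  congr 1
  refine Finset.sum_congr rfl fun k hk => ?_
  rw [coordProj_apply, if_pos hk]

lemma convexOn_activePenalty (A : Finset (Fin p)) {lam : ℝ} (hlam : 0 ≤ lam) (ξ s : ℝ)
    (pre b : EuclideanSpace ℝ (Fin p)) :
    ConvexOn ℝ Set.univ (activePenalty A lam ξ s pre b) := by
  refine ⟨convex_univ, fun u _ v _ a c ha hc hac => ?_⟩
  simp only [activePenalty, smul_eq_mul, PiLp.add_apply, PiLp.smul_apply]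
  have : ∀ k ∈ A, (|pre k| ^ ξ)⁻¹ * |b k + (a * u k + c * v k) / s| ≤
      a * ((|pre k| ^ ξ)⁻¹ * |b k + u k / s|) + c * ((|pre k| ^ ξ)⁻¹ * |b k + v k / s|) := by
    intro k _
    have h1 : b k + (a * u k + c * v k) / s = a * (b k + u k / s) + c * (b k + v k / s) := by
      have : b k = (a + c) * b k := by rw [hac, one_mul]
      nth_rw 1 [this]
      ring
    rw [h1]
    have h2 : |a * (b k + u k / s) + c * (b k + v k / s)| ≤
        a * |b k + u k / s| + c * |b k + v k / s| := by
      refine (abs_add_le _ _).trans ?_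
      rw [abs_mul, abs_mul, abs_of_nonneg ha, abs_of_nonneg hc]
    have h3 : 0 ≤ (|pre k| ^ ξ)⁻¹ := by positivity
    nlinarith
  have h := mul_le_mul_of_nonneg_left (Finset.sum_le_sum this) hlam
  refine h.trans (le_of_eq ?_)
  rw [Finset.sum_add_distrib, ← Finset.mul_sum, ← Finset.mul_sum]
  ring

lemma activePenalty_sub_le (A : Finset (Fin p)) {lam ξ s B : ℝ} (hlam : 0 ≤ lam) (hs : 0 < s)
    {pre : EuclideanSpace ℝ (Fin p)} (hB : ∀ k ∈ A, (|pre k| ^ ξ)⁻¹ ≤ B)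
    (b u v : EuclideanSpace ℝ (Fin p)) :
    activePenalty A lam ξ s pre b u - activePenalty A lam ξ s pre b v ≤
      lam / s * (A.card * B) * ‖u - v‖ := by
  have h : ∀ k ∈ A, (|pre k| ^ ξ)⁻¹ * |b k + u k / s| - (|pre k| ^ ξ)⁻¹ * |b k + v k / s| ≤
      B * (‖u - v‖ / s) := by
    intro k hk
    have h1 : |b k + u k / s| - |b k + v k / s| ≤ ‖u - v‖ / s := by
      refine (abs_sub_abs_le_abs_sub _ _).trans ?_
      have : b k + u k / s - (b k + v k / s) = (u - v) k / s := by
        rw [PiLp.sub_apply]; ring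
      rw [this, abs_div, abs_of_pos hs]
      gcongr
      exact abs_apply_le_norm _ _
    have h0 : 0 ≤ (|pre k| ^ ξ)⁻¹ := by positivity
    rw [← mul_sub]
    calc _ ≤ (|pre k| ^ ξ)⁻¹ * (‖u - v‖ / s) := by gcongr
      _ ≤ _ := by gcongr; exact hB k hk
  rw [activePenalty, activePenalty, ← mul_sub, ← Finset.sum_sub_distrib]
  calc _ ≤ lam * ∑ k ∈ A, B * (‖u - v‖ / s) := by gcongr with k hk; exact h k hk
    _ = _ := by rw [Finset.sum_const, nsmul_eq_mul]; ring

lemma weight_eq_ofReal {ξ b : ℝ} (hb : b ≠ 0) : weight ξ b = ENNReal.ofReal (|b| ^ ξ)⁻¹ := by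
  rw [weight, ENNReal.ofReal_inv_of_pos (by positivity)]

/-- The penalty of a vector supported on coordinates with finite weights. -/
lemma penalty_of_supported (A : Finset (Fin p)) {lam ξ : ℝ} (hlam : 0 ≤ lam)
    {pre b : EuclideanSpace ℝ (Fin p)} (hpre : ∀ k ∈ A, pre k ≠ 0) (hb : ∀ k ∉ A, b k = 0) :
    penalty lam ξ pre b = ENNReal.ofReal (lam * ∑ k ∈ A, (|pre k| ^ ξ)⁻¹ * |b k|) := by
  rw [penalty, ENNReal.ofReal_mul hlam,
    ENNReal.ofReal_sum_of_nonneg (fun k _ => by positivity)]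
  congr 1
  rw [← Finset.sum_subset (Finset.subset_univ A) (fun k _ hk => by simp [hb k hk])]
  refine Finset.sum_congr rfl fun k hk => ?_
  rw [weight_eq_ofReal (hpre k hk), ENNReal.ofReal_mul (by positivity)]

/-- A lower bound on the penalty when the weights off `A` are at least `c / lam`. An infinite
weight is allowed off `A`. -/
lemma le_penalty (A : Finset (Fin p)) {lam ξ c : ℝ} (hlam : 0 ≤ lam) (hc : 0 ≤ c)
    {pre : EuclideanSpace ℝ (Fin p)} (hpre : ∀ k ∈ A, pre k ≠ 0)
    (hw : ∀ k ∉ A, ENNReal.ofReal c ≤ ENNReal.ofReal lam * weight ξ (pre k))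
    (b : EuclideanSpace ℝ (Fin p)) :
    ENNReal.ofReal (lam * ∑ k ∈ A, (|pre k| ^ ξ)⁻¹ * |b k| + c * ∑ k ∈ Aᶜ, |b k|) ≤
      penalty lam ξ pre b := by
  rw [penalty, ← Finset.sum_add_sum_compl A, mul_add, ENNReal.ofReal_add (by positivity)
    (by positivity)]
  gcongr
  · rw [ENNReal.ofReal_mul hlam, ENNReal.ofReal_sum_of_nonneg (fun k _ => by positivity)]
    gcongr with k hk
    rw [weight_eq_ofReal (hpre k hk), ENNReal.ofReal_mul (by positivity)]
  · rw [ENNReal.ofReal_mul hc, ENNReal.ofReal_sum_of_nonneg (fun k _ => by positivity),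
      Finset.mul_sum, Finset.mul_sum]
    refine Finset.sum_le_sum fun k hk => ?_
    rw [← mul_assoc]
    gcongr
    exact hw k (Finset.mem_compl.1 hk)

/-- The increment of the empirical loss in the local parameter `u = s (β - b)`. -/
noncomputable def localLoss (L : ℝ → ℝ → ℝ) (I : Finset ℕ) (y : ℕ → ℝ)
    (x : ℕ → EuclideanSpace ℝ (Fin p)) (b : EuclideanSpace ℝ (Fin p)) (s : ℝ)
    (u : EuclideanSpace ℝ (Fin p)) : ℝ :=
  ∑ i ∈ I, (L (y i) (inner ℝ (x i) (b + s⁻¹ • u)) - L (y i) (inner ℝ (x i) b))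

lemma convexOn_localLoss {L : ℝ → ℝ → ℝ} (hC1 : ConvexSmoothLoss L) (I : Finset ℕ) (y : ℕ → ℝ)
    (x : ℕ → EuclideanSpace ℝ (Fin p)) (b : EuclideanSpace ℝ (Fin p)) (s : ℝ) :
    ConvexOn ℝ Set.univ (localLoss L I y x b s) := by
  refine ⟨convex_univ, fun u _ v _ a c ha hc hac => ?_⟩
  simp only [localLoss, smul_eq_mul, Finset.mul_sum, ← Finset.sum_add_distrib]
  refine Finset.sum_le_sum fun i _ => ?_
  have h1 : (inner ℝ (x i) (b + s⁻¹ • (a • u + c • v)) : ℝ) =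
      a • inner ℝ (x i) (b + s⁻¹ • u) + c • inner ℝ (x i) (b + s⁻¹ • v) := by
    simp only [inner_add_right, inner_smul_right, smul_eq_mul]
    linear_combination (inner ℝ (x i) b : ℝ) * (-hac)
  have h2 := (hC1 (y i)).1.2 (Set.mem_univ (inner ℝ (x i) (b + s⁻¹ • u)))
    (Set.mem_univ (inner ℝ (x i) (b + s⁻¹ • v))) ha hc hac
  rw [h1]
  simp only [smul_eq_mul] at h2 ⊢
  have : L (y i) (inner ℝ (x i) b) = a * L (y i) (inner ℝ (x i) b) +
      c * L (y i) (inner ℝ (x i) b) := by rw [← add_mul, hac, one_mul]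
  linarith

/-- The minimum property of the adaptive lasso in local coordinates, in real numbers: compared
with vectors supported on `A`, the estimate pays at least `c ‖û - π û‖` for its components
off `A`. -/
lemma IsAdaptiveLasso.localLoss_add_le {L : ℝ → ℝ → ℝ} {I : Finset ℕ} {y : ℕ → ℝ}
    {x : ℕ → EuclideanSpace ℝ (Fin p)} {lam ξ : ℝ} {pre b bhat : EuclideanSpace ℝ (Fin p)}
    (h : IsAdaptiveLasso L I y x lam ξ pre bhat) (hlam : 0 ≤ lam) {s c : ℝ} (hs : 0 < s)
    (hc : 0 ≤ c) (A : Finset (Fin p)) (hb : ∀ k ∉ A, b k = 0) (hpre : ∀ k ∈ A, pre k ≠ 0)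
    (hw : ∀ k ∉ A, ENNReal.ofReal (c * s) ≤ ENNReal.ofReal lam * weight ξ (pre k))
    {u' : EuclideanSpace ℝ (Fin p)} (hu' : coordProj A u' = u') :
    localLoss L I y x b s (s • (bhat - b)) + activePenalty A lam ξ s pre b (s • (bhat - b))
        + c * ‖s • (bhat - b) - coordProj A (s • (bhat - b))‖ ≤
      localLoss L I y x b s u' + activePenalty A lam ξ s pre b u' := by
  set u := s • (bhat - b) with hu
  have hbu : bhat = b + s⁻¹ • u := by
    rw [hu, inv_smul_smul₀ hs.ne']; abel
  have hmin := h (b + s⁻¹ • u')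
  have hcoord : ∀ (v : EuclideanSpace ℝ (Fin p)) k, (b + s⁻¹ • v) k = b k + v k / s := by
    intro v k
    rw [PiLp.add_apply, PiLp.smul_apply, smul_eq_mul, div_eq_inv_mul]
  have hp' : penalty lam ξ pre (b + s⁻¹ • u') =
      ENNReal.ofReal (activePenalty A lam ξ s pre b u') := by
    rw [penalty_of_supported A hlam hpre]
    · simp only [hcoord, activePenalty]
    · intro k hk
      rw [hcoord, hb k hk, (coordProj_eq_self_iff A u').1 hu' k hk]
      simp
  have hp := le_penalty A (c := c * s) hlam (by positivity) hpre hw bhat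
  have hpos : 0 ≤ activePenalty A lam ξ s pre b u' := by unfold activePenalty; positivity
  have hpos2 : 0 ≤ lam * ∑ k ∈ A, (|pre k| ^ ξ)⁻¹ * |bhat k| + c * s * ∑ k ∈ Aᶜ, |bhat k| := by
    positivity
  rw [criterion, criterion, hp'] at hmin
  have hmin2 := (add_le_add_right (EReal.coe_ennreal_le_coe_ennreal_iff.2 hp) _).trans hmin
  rw [EReal.coe_ennreal_ofReal, EReal.coe_ennreal_ofReal, max_eq_left hpos, max_eq_left hpos2,
    ← EReal.coe_add, ← EReal.coe_add, EReal.coe_le_coe_iff] at hmin2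
  have h1 : activePenalty A lam ξ s pre b u = lam * ∑ k ∈ A, (|pre k| ^ ξ)⁻¹ * |bhat k| := by
    simp only [activePenalty, ← hcoord, ← hbu]
  have h2 : c * ‖u - coordProj A u‖ ≤ c * s * ∑ k ∈ Aᶜ, |bhat k| := by
    rw [mul_assoc]
    gcongr
    refine (norm_sub_coordProj_le A u).trans ?_
    rw [Finset.mul_sum]
    refine Finset.sum_le_sum fun k hk => ?_
    rw [hu, PiLp.smul_apply, PiLp.sub_apply, hb k (Finset.mem_compl.1 hk), smul_eq_mul, sub_zero,
      abs_mul, abs_of_pos hs]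
  simp only [localLoss, Finset.sum_sub_distrib, ← hbu]
  linarith

/-- Weights off the support: if `s |pre| ≤ M`, then the weight is at least `(s / M)^ξ`. -/
lemma ofReal_le_mul_weight {lam ξ s M c q : ℝ} (hlam : 0 ≤ lam) (hξ : 0 < ξ) (hs : 0 < s)
    (hM : 0 < M) (hq : s * |q| ≤ M) (hlarge : c * M ^ ξ ≤ lam * s ^ (ξ - 1)) (hlam' : 0 < lam) :
    ENNReal.ofReal (c * s) ≤ ENNReal.ofReal lam * weight ξ q := by
  rcases eq_or_ne q 0 with rfl | hq0
  · rw [weight]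
    simp only [abs_zero, Real.zero_rpow hξ.ne', ENNReal.ofReal_zero, ENNReal.inv_zero]
    rw [ENNReal.mul_top (by simpa using hlam')]
    exact le_top
  · rw [weight_eq_ofReal hq0, ← ENNReal.ofReal_mul hlam]
    refine ENNReal.ofReal_le_ofReal ?_
    have h1 : |q| ≤ M / s := by rw [le_div_iff₀ hs]; linarith
    have h2 : |q| ^ ξ ≤ (M / s) ^ ξ := Real.rpow_le_rpow (abs_nonneg _) h1 hξ.le
    have h3 : ((M / s) ^ ξ)⁻¹ ≤ (|q| ^ ξ)⁻¹ := by
      apply inv_anti₀ _ h2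
      positivity
    have h4 : lam * ((M / s) ^ ξ)⁻¹ ≤ lam * (|q| ^ ξ)⁻¹ := by gcongr
    refine le_trans ?_ h4
    rw [Real.div_rpow hM.le hs.le, inv_div, ← mul_div_assoc, le_div_iff₀ (by positivity)]
    have h5 : s ^ ξ = s ^ (ξ - 1) * s := by
      rw [← Real.rpow_add_one hs.ne']; ring_nf
    rw [h5]
    nlinarith

end AdaptiveLasso

/-! ### Quadratic forms on the active coordinates -/

namespace AdaptiveLasso

lemma _root_.Matrix.PosDef.exists_forall_le_inner {ι : Type*} [Fintype ι] [DecidableEq ι]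
    {M : Matrix ι ι ℝ} (hM : M.PosDef) :
    ∃ κ : ℝ, 0 < κ ∧ ∀ v : EuclideanSpace ℝ ι,
      κ * ‖v‖ ^ 2 ≤ inner ℝ v (Matrix.toEuclideanCLM (𝕜 := ℝ) M v) := by
  rcases subsingleton_or_nontrivial (EuclideanSpace ℝ ι) with h | h
  · exact ⟨1, one_pos, fun v => by simp [Subsingleton.elim v 0]⟩
  have hcont : Continuous fun v : EuclideanSpace ℝ ι =>
      (inner ℝ v (Matrix.toEuclideanCLM (𝕜 := ℝ) M v) : ℝ) := by fun_prop
  obtain ⟨v₀, hv₀, hmin⟩ := (isCompact_sphere (0 : EuclideanSpace ℝ ι) 1).exists_isMinOn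
    (NormedSpace.sphere_nonempty.2 zero_le_one) hcont.continuousOn
  refine ⟨(inner ℝ v₀ (Matrix.toEuclideanCLM (𝕜 := ℝ) M v₀) : ℝ), ?_, fun v => ?_⟩
  · have hne : v₀ ≠ 0 := by
      rintro rfl
      simp at hv₀
    rw [Matrix.inner_toEuclideanCLM]
    have := hM.dotProduct_mulVec_pos (x := v₀.ofLp) (by simpa using hne)
    simpa using this
  · rcases eq_or_ne v 0 with rfl | hv
    · simp
    have hn : 0 < ‖v‖ := norm_pos_iff.2 hv
    have h1 := hmin (a := ‖v‖⁻¹ • v) (by simp [norm_smul, hn.ne'])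
    simp only [Set.mem_ofPred_eq, map_smul, inner_smul_left, inner_smul_right, RCLike.conj_to_real]
      at h1
    have h2 := mul_le_mul_of_nonneg_right h1 (sq_nonneg ‖v‖)
    refine h2.trans (le_of_eq ?_)
    field_simp

variable {p : ℕ}

lemma subvec_apply (A : Finset (Fin p)) (u : EuclideanSpace ℝ (Fin p)) (k : A) :
    subvec A u k = u k := rfl

/-- The vector with the given coordinates in `A` and zeros elsewhere. -/
noncomputable def embedVec (A : Finset (Fin p)) (v : EuclideanSpace ℝ A) :
    EuclideanSpace ℝ (Fin p) :=
  WithLp.toLp 2 fun k => if h : k ∈ A then v ⟨k, h⟩ else 0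

lemma embedVec_apply (A : Finset (Fin p)) (v : EuclideanSpace ℝ A) (k : Fin p) :
    embedVec A v k = if h : k ∈ A then v ⟨k, h⟩ else 0 := rfl

lemma subvec_embedVec (A : Finset (Fin p)) (v : EuclideanSpace ℝ A) :
    subvec A (embedVec A v) = v := by
  ext k
  simp [subvec_apply, embedVec_apply]

lemma coordProj_embedVec (A : Finset (Fin p)) (v : EuclideanSpace ℝ A) :
    coordProj A (embedVec A v) = embedVec A v := by
  rw [coordProj_eq_self_iff]
  intro k hk
  rw [embedVec_apply, dif_neg hk]

lemma inner_eq_inner_subvec (A : Finset (Fin p)) (w : EuclideanSpace ℝ (Fin p))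
    {v : EuclideanSpace ℝ (Fin p)} (hv : coordProj A v = v) :
    (inner ℝ w v : ℝ) = inner ℝ (subvec A w) (subvec A v) := by
  rw [coordProj_eq_self_iff] at hv
  rw [inner_eq_sum, PiLp.inner_apply]
  simp only [subvec_apply, RCLike.inner_apply, conj_trivial]
  rw [Finset.sum_coe_sort A (fun k => v k * w k),
    ← Finset.sum_subset (Finset.subset_univ A) (fun k _ hk => by simp [hv k hk])]
  exact Finset.sum_congr rfl fun k _ => mul_comm _ _

lemma norm_subvec_eq (A : Finset (Fin p)) {v : EuclideanSpace ℝ (Fin p)}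
    (hv : coordProj A v = v) : ‖subvec A v‖ = ‖v‖ := by
  rw [← sq_eq_sq₀ (norm_nonneg _) (norm_nonneg _), ← real_inner_self_eq_norm_sq,
    ← real_inner_self_eq_norm_sq, inner_eq_inner_subvec A v hv]

lemma norm_embedVec (A : Finset (Fin p)) (v : EuclideanSpace ℝ A) : ‖embedVec A v‖ = ‖v‖ := by
  rw [← norm_subvec_eq A (coordProj_embedVec A v), subvec_embedVec]

lemma subvec_sub (A : Finset (Fin p)) (u v : EuclideanSpace ℝ (Fin p)) :
    subvec A (u - v) = subvec A u - subvec A v := rfl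

lemma subvec_smul (A : Finset (Fin p)) (c : ℝ) (u : EuclideanSpace ℝ (Fin p)) :
    subvec A (c • u) = c • subvec A u := rfl

lemma norm_subvec_le (A : Finset (Fin p)) (u : EuclideanSpace ℝ (Fin p)) :
    ‖subvec A u‖ ≤ ‖u‖ := by
  have h : subvec A u = subvec A (coordProj A u) := by
    ext k
    simp [subvec_apply, coordProj_apply]
  rw [h, norm_subvec_eq A (coordProj_coordProj A u)]
  exact norm_coordProj_le A u

lemma continuous_subvec (A : Finset (Fin p)) : Continuous (subvec A) := by
  unfold subvec; fun_prop

lemma quadForm_eq_inner (M : Matrix (Fin p) (Fin p) ℝ) (u : EuclideanSpace ℝ (Fin p)) :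
    quadForm M u = inner ℝ u (Matrix.toEuclideanCLM (𝕜 := ℝ) M u) := by
  rw [inner_eq_sum, quadForm]
  refine Finset.sum_congr rfl fun k _ => ?_
  rw [Matrix.ofLp_toEuclideanCLM, Matrix.mulVec, dotProduct, Finset.mul_sum]
  exact Finset.sum_congr rfl fun l _ => by ring

lemma subvec_toEuclideanCLM (A : Finset (Fin p)) (M : Matrix (Fin p) (Fin p) ℝ)
    {v : EuclideanSpace ℝ (Fin p)} (hv : coordProj A v = v) :
    subvec A (Matrix.toEuclideanCLM (𝕜 := ℝ) M v) =
      Matrix.toEuclideanCLM (𝕜 := ℝ) (submat A M) (subvec A v) := by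
  rw [coordProj_eq_self_iff] at hv
  ext k
  rw [subvec_apply, Matrix.ofLp_toEuclideanCLM, Matrix.ofLp_toEuclideanCLM, Matrix.mulVec,
    Matrix.mulVec, dotProduct, dotProduct]
  simp only [subvec_apply, submat, Matrix.submatrix_apply]
  rw [Finset.sum_coe_sort A (fun l => M k l * v l),
    ← Finset.sum_subset (Finset.subset_univ A) (fun k _ hk => by simp [hv k hk])]

lemma quadForm_eq_of_supported (A : Finset (Fin p)) (M : Matrix (Fin p) (Fin p) ℝ)
    {v : EuclideanSpace ℝ (Fin p)} (hv : coordProj A v = v) :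
    quadForm M v = inner ℝ (subvec A v)
      (Matrix.toEuclideanCLM (𝕜 := ℝ) (submat A M) (subvec A v)) := by
  rw [quadForm_eq_inner, real_inner_comm, inner_eq_inner_subvec A _ hv,
    subvec_toEuclideanCLM A M hv, real_inner_comm]

/-- The minimizer `(-M_A⁻¹ w_A, 0)` of `u ↦ ⟪w, u⟫ + uᵀ M u / 2` over vectors supported on `A`. -/
noncomputable def quadMin (A : Finset (Fin p)) (M : Matrix (Fin p) (Fin p) ℝ)
    (w : EuclideanSpace ℝ (Fin p)) : EuclideanSpace ℝ (Fin p) :=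
  embedVec A (-Matrix.toEuclideanCLM (𝕜 := ℝ) (submat A M)⁻¹ (subvec A w))

lemma coordProj_quadMin (A : Finset (Fin p)) (M : Matrix (Fin p) (Fin p) ℝ)
    (w : EuclideanSpace ℝ (Fin p)) : coordProj A (quadMin A M w) = quadMin A M w :=
  coordProj_embedVec A _

lemma norm_quadMin_le (A : Finset (Fin p)) (M : Matrix (Fin p) (Fin p) ℝ)
    (w : EuclideanSpace ℝ (Fin p)) :
    ‖quadMin A M w‖ ≤ ‖Matrix.toEuclideanCLM (𝕜 := ℝ) (submat A M)⁻¹‖ * ‖w‖ := by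
  rw [quadMin, norm_embedVec, norm_neg]
  refine (ContinuousLinearMap.le_opNorm _ _).trans ?_
  gcongr
  exact norm_subvec_le A w

/-- Completing the square on the coordinates in `A`. -/
lemma quadratic_sub_quadMin (A : Finset (Fin p)) {M : Matrix (Fin p) (Fin p) ℝ}
    (hM : M.IsSymm) (hdet : IsUnit (submat A M).det) (w : EuclideanSpace ℝ (Fin p))
    {v : EuclideanSpace ℝ (Fin p)} (hv : coordProj A v = v) :
    inner ℝ w v + quadForm M v / 2 -
        (inner ℝ w (quadMin A M w) + quadForm M (quadMin A M w) / 2) =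
      quadForm M (v - quadMin A M w) / 2 := by
  set m := quadMin A M w with hm
  set d := v - m with hd
  have hmA : coordProj A m = m := coordProj_quadMin A M w
  have hdA : coordProj A d = d := by rw [hd, map_sub, hv, hmA]
  have hv' : v = m + d := by rw [hd]; abel
  have hsym : (inner ℝ m (Matrix.toEuclideanCLM (𝕜 := ℝ) M d) : ℝ) =
      inner ℝ d (Matrix.toEuclideanCLM (𝕜 := ℝ) M m) := by
    rw [Matrix.inner_toEuclideanCLM, Matrix.inner_toEuclideanCLM, Matrix.dotProduct_mulVec,
      ← Matrix.mulVec_transpose, hM.eq, dotProduct_comm]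
  -- `m` is the critical point on `A`: `(M m)_A = -w_A`
  have hcrit : (inner ℝ d (Matrix.toEuclideanCLM (𝕜 := ℝ) M m) : ℝ) = - inner ℝ w d := by
    rw [real_inner_comm, inner_eq_inner_subvec A _ hdA, inner_eq_inner_subvec A _ hdA,
      subvec_toEuclideanCLM A M hmA, hm, quadMin, subvec_embedVec, map_neg, inner_neg_left]
    congr 2
    rw [← ContinuousLinearMap.comp_apply, ← ContinuousLinearMap.mul_def, ← map_mul,
      Matrix.mul_nonsing_inv _ hdet, map_one, one_apply_eq_self]
  rw [hv']
  simp only [quadForm_eq_inner, map_add, inner_add_left, inner_add_right]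
  linarith

lemma abs_quadForm_le (M : Matrix (Fin p) (Fin p) ℝ) (u : EuclideanSpace ℝ (Fin p)) :
    |quadForm M u| ≤ (∑ k, ∑ l, |M k l|) * ‖u‖ ^ 2 := by
  have := abs_quadForm_sub_le M 0 u
  simpa [quadForm] using this

/-! ### Expansion of the empirical loss -/

/-- The normalized empirical score `|I|^{-1/2} ∑_{i ∈ I} L'(y_i, x_iᵀb) x_i`. -/
noncomputable def normScore (L : ℝ → ℝ → ℝ) (b : EuclideanSpace ℝ (Fin p)) (I : Finset ℕ)
    (z : ℕ → ℝ × EuclideanSpace ℝ (Fin p)) : EuclideanSpace ℝ (Fin p) :=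
  (√(I.card : ℝ))⁻¹ • ∑ i ∈ I, score L b (z i)

/-- The mean of `f` over the sample. -/
noncomputable def sampleMean (f : ℝ × EuclideanSpace ℝ (Fin p) → ℝ) (I : Finset ℕ)
    (z : ℕ → ℝ × EuclideanSpace ℝ (Fin p)) : ℝ :=
  (∑ i ∈ I, f (z i)) / I.card

/-- Distance between the empirical Hessian of the loss at `b` and the matrix `M`. -/
noncomputable def hessianError (L : ℝ → ℝ → ℝ) (b : EuclideanSpace ℝ (Fin p))
    (M : Matrix (Fin p) (Fin p) ℝ) (I : Finset ℕ)
    (z : ℕ → ℝ × EuclideanSpace ℝ (Fin p)) : ℝ :=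
  ∑ k, ∑ l, |sampleMean (psiIntegrand L b k l) I z - M k l|

/-- Second-order expansion of the empirical loss in the local parameter. -/
lemma abs_localLoss_sub_le {L : ℝ → ℝ → ℝ} (hC1 : ConvexSmoothLoss L)
    {b : EuclideanSpace ℝ (Fin p)} {g : EuclideanSpace ℝ (Fin p) → ℝ} {ρ : ℝ} {I : Finset ℕ}
    (hI : 0 < I.card) {z : ℕ → ℝ × EuclideanSpace ℝ (Fin p)}
    (hz : ∀ i ∈ I, ∀ b' ∈ Metric.ball b ρ,
      |iteratedDeriv 3 (L (z i).1) (inner ℝ (z i).2 b')| ≤ g (z i).2)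
    (M : Matrix (Fin p) (Fin p) ℝ) {u : EuclideanSpace ℝ (Fin p)}
    (hu : ‖u‖ / √(I.card : ℝ) < ρ) :
    |localLoss L I (fun i => (z i).1) (fun i => (z i).2) b (√(I.card : ℝ)) u -
        (inner ℝ (normScore L b I z) u + quadForm M u / 2)| ≤
      hessianError L b M I z * ‖u‖ ^ 2 / 2 +
        sampleMean (cubicEnvelope g) I z * ‖u‖ ^ 3 / (6 * √(I.card : ℝ)) := by
  set n : ℝ := (I.card : ℝ) with hn
  have hn0 : 0 < n := by rw [hn]; exact_mod_cast hI
  set s := √n with hs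
  have hs0 : 0 < s := Real.sqrt_pos.2 hn0
  have hss : s * s = n := Real.mul_self_sqrt hn0.le
  set H : Matrix (Fin p) (Fin p) ℝ :=
    Matrix.of fun k l => sampleMean (psiIntegrand L b k l) I z with hH
  have hnu : ‖s⁻¹ • u‖ = ‖u‖ / s := by
    rw [norm_smul, norm_inv, Real.norm_eq_abs, abs_of_pos hs0, div_eq_inv_mul]
  have h1 := fun i (hi : i ∈ I) =>
    abs_loss_expansion_le hC1 (hz i hi) (u := s⁻¹ • u) (by rw [hnu]; exact hu)
  have h2 := (Finset.abs_sum_le_sum_abs _ _).trans (Finset.sum_le_sum h1)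
  have hq : ∑ i ∈ I, quadForm (Matrix.of fun k l => psiIntegrand L b k l (z i)) (s⁻¹ • u) =
      quadForm H u := by
    simp only [quadForm, hH, Matrix.of_apply, sampleMean, PiLp.smul_apply, smul_eq_mul]
    rw [Finset.sum_comm]
    refine Finset.sum_congr rfl fun k _ => ?_
    rw [Finset.sum_comm]
    refine Finset.sum_congr rfl fun l _ => ?_
    rw [← Finset.sum_mul, ← hn, ← hss]
    field_simp
  have hsc : ∑ i ∈ I, (inner ℝ (score L b (z i)) (s⁻¹ • u) : ℝ) =
      inner ℝ (normScore L b I z) u := by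
    rw [normScore, real_inner_smul_left, sum_inner, Finset.mul_sum]
    simp only [inner_smul_right, ← hn, ← hs]
  have hcu : ∑ i ∈ I, cubicEnvelope g (z i) * ‖s⁻¹ • u‖ ^ 3 / 6 =
      sampleMean (cubicEnvelope g) I z * ‖u‖ ^ 3 / (6 * s) := by
    rw [← Finset.sum_div, ← Finset.sum_mul, hnu, sampleMean, ← hn, ← hss]
    field_simp
  rw [hcu] at h2
  simp only [Finset.sum_sub_distrib, ← Finset.sum_div] at h2
  rw [hq, hsc, ← Finset.sum_sub_distrib] at h2
  have h3 := abs_quadForm_sub_le H M u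
  have h4 : (∑ k, ∑ l, |H k l - M k l|) = hessianError L b M I z := rfl
  rw [h4] at h3
  rw [localLoss]
  have h5 : ∀ a b c d : ℝ, a - (b + c) = (a - b - d) + (d - c) := by intros; ring
  rw [h5 _ _ _ (quadForm H u / 2)]
  refine (abs_add_le _ _).trans ?_
  have h6 : |quadForm H u / 2 - quadForm M u / 2| ≤ hessianError L b M I z * ‖u‖ ^ 2 / 2 := by
    rw [← sub_div, abs_div, abs_of_pos (by norm_num : (0 : ℝ) < 2)]
    gcongr
  linarith

/-- The deterministic core. On samples where the score is bounded by `R₀`, where the Hessian and the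
mean of the cubic envelope are controlled, and where the pre-estimate is `Mp`-close to `b` in local
coordinates, the adaptive lasso vanishes off `A` and is `ε`-close, in local coordinates, to the minimizer of the limiting quadratic on `A`. -/
lemma localization_of_good_sample {L : ℝ → ℝ → ℝ} (hC1 : ConvexSmoothLoss L)
    {b : EuclideanSpace ℝ (Fin p)} {g : EuclideanSpace ℝ (Fin p) → ℝ} {ρ : ℝ} {I : Finset ℕ}
    (hI : 0 < I.card) {z : ℕ → ℝ × EuclideanSpace ℝ (Fin p)}
    (hz : ∀ i ∈ I, ∀ b' ∈ Metric.ball b ρ,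
      |iteratedDeriv 3 (L (z i).1) (inner ℝ (z i).2 b')| ≤ g (z i).2)
    {M : Matrix (Fin p) (Fin p) ℝ} (hM : M.IsSymm)
    (A : Finset (Fin p)) (hdet : IsUnit (submat A M).det) (hbA : ∀ k ∉ A, b k = 0)
    {κ : ℝ} (hκ : 0 < κ) (hcoer : ∀ v, coordProj A v = v → κ * ‖v‖ ^ 2 ≤ quadForm M v / 2)
    {R₀ R C δ ε G B Mp lam ξ : ℝ} {pre bhat : EuclideanSpace ℝ (Fin p)}
    (hε : 0 < ε) (hε1 : ε ≤ 1) (hδ0 : 0 < δ) (hδ1 : δ < κ * ε ^ 2 / 4) (hδ2 : δ < ε / 2)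
    (hR : ‖Matrix.toEuclideanCLM (𝕜 := ℝ) (submat A M)⁻¹‖ * R₀ + 1 ≤ R)
    (hC : 2 * (R₀ * (R + 1) + (∑ k, ∑ l, |M k l|) * (R + 1) ^ 2 / 2 + δ) + 1 ≤ C)
    (hρ : (R + 1) / √(I.card : ℝ) < ρ)
    (hscore : ‖normScore L b I z‖ ≤ R₀)
    (hhess : hessianError L b M I z * (R + 1) ^ 2 / 2 ≤ δ / 8)
    (hcubic : sampleMean (cubicEnvelope g) I z ≤ G)
    (hG : 0 ≤ G) (hG' : G * (R + 1) ^ 3 / (6 * √(I.card : ℝ)) ≤ δ / 8)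
    (hlam : 0 < lam) (hξ : 0 < ξ) (hMp : 0 < Mp)
    (hpre : ‖√(I.card : ℝ) • (pre - b)‖ ≤ Mp)
    (hpre0 : ∀ k ∈ A, pre k ≠ 0) (hB : ∀ k ∈ A, (|pre k| ^ ξ)⁻¹ ≤ B) (hB0 : 0 ≤ B)
    (hpen : lam / √(I.card : ℝ) * (A.card * B) * (2 * R) ≤ δ / 2)
    (hlarge : C * Mp ^ ξ ≤ lam * √(I.card : ℝ) ^ (ξ - 1))
    (hlasso : IsAdaptiveLasso L I (fun i => (z i).1) (fun i => (z i).2) lam ξ pre bhat) :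
    ‖√(I.card : ℝ) • (bhat - b) - quadMin A M (normScore L b I z)‖ < ε ∧
      coordProj A (√(I.card : ℝ) • (bhat - b)) = √(I.card : ℝ) • (bhat - b) := by
  set s := √(I.card : ℝ) with hs
  have hs0 : 0 < s := Real.sqrt_pos.2 (by exact_mod_cast hI)
  set W := normScore L b I z with hW
  set y : ℕ → ℝ := fun i => (z i).1
  set x : ℕ → EuclideanSpace ℝ (Fin p) := fun i => (z i).2
  have hR₀ : 0 ≤ R₀ := (norm_nonneg _).trans hscore
  have hm : ‖quadMin A M W‖ + 1 ≤ R := by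
    refine le_trans ?_ hR
    gcongr
    refine (norm_quadMin_le A M W).trans ?_
    gcongr
  have hR1 : 1 ≤ R := by linarith [norm_nonneg (quadMin A M W)]
  have hHE : 0 ≤ hessianError L b M I z :=
    Finset.sum_nonneg fun k _ => Finset.sum_nonneg fun l _ => abs_nonneg _
  have hexp : ∀ u, ‖u‖ ≤ R + 1 →
      |localLoss L I y x b s u - (inner ℝ W u + quadForm M u / 2)| ≤ δ / 4 := by
    intro u hu
    have h1 : ‖u‖ / s < ρ := lt_of_le_of_lt (by gcongr) hρ
    refine (abs_localLoss_sub_le hC1 hI hz M h1).trans ?_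
    have h2 : hessianError L b M I z * ‖u‖ ^ 2 / 2 ≤ δ / 8 := le_trans (by gcongr) hhess
    have h3 : sampleMean (cubicEnvelope g) I z * ‖u‖ ^ 3 / (6 * s) ≤ δ / 8 :=
      le_trans (by gcongr) hG'
    linarith
  refine norm_sub_lt_and_proj_eq_of_penalized_min
    (S := localLoss L I y x b s) (T := activePenalty A lam ξ s pre b)
    (M := R₀ * (R + 1) + (∑ k, ∑ l, |M k l|) * (R + 1) ^ 2 / 2 + δ) (R := R) (C := C)
    (κ := κ) (δ := δ)
    (convexOn_localLoss hC1 I y x b s) (convexOn_activePenalty A hlam.le ξ s pre b)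
    (coordProj A) (coordProj_coordProj A) (norm_coordProj_le A)
    (activePenalty_coordProj A lam ξ s pre b) ?_ hC (coordProj_quadMin A M W) hm ?_ ?_
    hε hε1 hκ hδ1 hδ2
  · intro v hv
    have h1 := hexp v hv
    have h2 : |inner ℝ W v| ≤ R₀ * (R + 1) := by
      refine (abs_real_inner_le_norm _ _).trans ?_
      gcongr
    have h3 : |quadForm M v| ≤ (∑ k, ∑ l, |M k l|) * (R + 1) ^ 2 := by
      refine (abs_quadForm_le M v).trans ?_
      gcongr
    rw [abs_le] at *
    constructor <;> linarith [h1.1, h1.2, h2.1, h2.2, h3.1, h3.2]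
  · intro u' hu'
    have hC0 : 0 ≤ C := by
      refine le_trans ?_ hC
      positivity
    refine hlasso.localLoss_add_le hlam.le hs0 hC0 A hbA hpre0 ?_ hu'
    intro k hk
    refine ofReal_le_mul_weight hlam.le hξ hs0 hMp ?_ hlarge hlam
    have h1 := (abs_apply_le_norm (s • (pre - b)) k).trans hpre
    rwa [PiLp.smul_apply, PiLp.sub_apply, hbA k hk, sub_zero, smul_eq_mul, abs_mul,
      abs_of_pos hs0] at h1
  · intro v hv hvR
    have h1 := (abs_le.1 (hexp v (by linarith))).1
    have h2 := (abs_le.1 (hexp (quadMin A M W) (by linarith))).2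
    have h3 := quadratic_sub_quadMin A hM hdet W hv
    have h4 := hcoer (v - quadMin A M W) (by rw [map_sub, hv, coordProj_quadMin])
    have h5 := activePenalty_sub_le A hlam.le hs0 hB b (quadMin A M W) v
    have h6 : lam / s * (A.card * B) * ‖quadMin A M W - v‖ ≤ δ / 2 := by
      refine le_trans ?_ hpen
      gcongr
      exact (norm_sub_le _ _).trans (by linarith)
    linarith

end AdaptiveLasso

/-! ### Limit theorems for samples with arbitrary index sets -/

namespace AdaptiveLasso

section Sampling

variable {Ω 𝓩 : Type*} [MeasurableSpace Ω] [MeasurableSpace 𝓩] {μ : Measure Ω}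
  {P : Measure 𝓩} {Z : ℕ → Ω → 𝓩}

lemma aemeasurable_comp_of_hasLaw {F : Type*} [MeasurableSpace F]
    (hlaw : ∀ i, HasLaw (Z i) P μ) {f : 𝓩 → F} (hf : AEMeasurable f P) (i : ℕ) :
    AEMeasurable (fun ω => f (Z i ω)) μ :=
  AEMeasurable.comp_aemeasurable (by rw [(hlaw i).map_eq]; exact hf) (hlaw i).aemeasurable

lemma map_comp_of_hasLaw {F : Type*} [MeasurableSpace F]
    (hlaw : ∀ i, HasLaw (Z i) P μ) {f : 𝓩 → F} (hf : AEMeasurable f P) (i : ℕ) :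
    μ.map (fun ω => f (Z i ω)) = P.map f := by
  have := AEMeasurable.map_map_of_aemeasurable (g := f) (f := Z i) (μ := μ)
    (by rw [(hlaw i).map_eq]; exact hf) (hlaw i).aemeasurable
  rw [(hlaw i).map_eq] at this
  exact this.symm

lemma iIndepFun_comp_of_hasLaw {F : Type*} [MeasurableSpace F] (hindep : iIndepFun Z μ)
    (hlaw : ∀ i, HasLaw (Z i) P μ) {f : 𝓩 → F} (hf : AEMeasurable f P) :
    iIndepFun (fun i ω => f (Z i ω)) μ :=
  hindep.comp₀ (fun _ => f) (fun i => (hlaw i).aemeasurable)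
    (fun i => by rw [(hlaw i).map_eq]; exact hf)

lemma charFun_map_sum_of_hasLaw {F : Type*} [NormedAddCommGroup F] [InnerProductSpace ℝ F]
    [MeasurableSpace F] [BorelSpace F] [SecondCountableTopology F] (hindep : iIndepFun Z μ)
    (hlaw : ∀ i, HasLaw (Z i) P μ) {f : 𝓩 → F} (hf : AEMeasurable f P) (I : Finset ℕ) (v : F) :
    charFun (μ.map fun ω => ∑ i ∈ I, f (Z i ω)) v = charFun (P.map f) v ^ I.card := by
  have h := iIndepFun_comp_of_hasLaw hindep hlaw hf
  rw [(h.restrict I).charFun_map_fun_finsetSum_eq_prod (s := I)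
    (fun i _ => aemeasurable_comp_of_hasLaw hlaw hf i)]
  simp [map_comp_of_hasLaw hlaw hf]

variable [IsProbabilityMeasure μ]

/-- The **weak law of large numbers** over samples with arbitrary finite index sets whose size
tends to infinity. The index sets need not be nested; only the law of the sample mean matters, so
that it follows from the strong law for initial segments. -/
lemma tendsto_measure_sampleMean_sub {f : 𝓩 → ℝ} (hindep : iIndepFun Z μ)
    (hlaw : ∀ i, HasLaw (Z i) P μ) (hf : Integrable f P) {I : ℕ → Finset ℕ}
    (hI : Tendsto (fun t => (I t).card) atTop atTop) {ε : ℝ} (hε : 0 < ε) :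
    Tendsto (fun t => μ {ω | ε ≤ |(∑ i ∈ I t, f (Z i ω)) / (I t).card - ∫ z, f z ∂P|})
      atTop (𝓝 0) := by
  have hfm := hf.aemeasurable
  have hmap := map_comp_of_hasLaw hlaw hfm
  have hae := aemeasurable_comp_of_hasLaw hlaw hfm
  have hint : ∀ i, Integrable (fun ω => f (Z i ω)) μ := fun i =>
    Integrable.comp_aemeasurable (f := Z i) (g := f) (by rw [(hlaw i).map_eq]; exact hf)
      (hlaw i).aemeasurable
  have hmean : ∫ ω, f (Z 0 ω) ∂μ = ∫ z, f z ∂P := by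
    rw [← (hlaw 0).map_eq, integral_map (hlaw 0).aemeasurable]
    rw [(hlaw 0).map_eq]
    exact hf.aestronglyMeasurable
  have hind := iIndepFun_comp_of_hasLaw hindep hlaw hfm
  have hslln := strong_law_ae_real (fun i ω => f (Z i ω)) (hint 0)
    (fun i j hij => hind.indepFun hij)
    (fun i => ⟨hae i, hae 0, by rw [hmap i, hmap 0]⟩)
  have hsum : ∀ J : Finset ℕ, AEMeasurable (fun ω => ∑ i ∈ J, f (Z i ω)) μ := fun J =>
    Finset.aemeasurable_fun_sum _ fun i _ => hae i
  have hprob := tendstoInMeasure_of_tendsto_ae (μ := μ)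
    (f := fun (n : ℕ) ω => (∑ i ∈ Finset.range n, f (Z i ω)) / n)
    (g := fun _ => μ[fun ω => f (Z 0 ω)])
    (fun n => ((hsum _).div_const _).aestronglyMeasurable) hslln
  rw [tendstoInMeasure_iff_norm] at hprob
  refine ((hprob ε hε).comp hI).congr fun t => ?_
  have hlaweq : μ.map (fun ω => ∑ i ∈ Finset.range (I t).card, f (Z i ω)) =
      μ.map (fun ω => ∑ i ∈ I t, f (Z i ω)) := by
    have : IsProbabilityMeasure (μ.map fun ω => ∑ i ∈ Finset.range (I t).card, f (Z i ω)) :=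
      Measure.isProbabilityMeasure_map (hsum _)
    have : IsProbabilityMeasure (μ.map fun ω => ∑ i ∈ I t, f (Z i ω)) :=
      Measure.isProbabilityMeasure_map (hsum _)
    refine Measure.ext_of_charFun (funext fun v => ?_)
    rw [charFun_map_sum_of_hasLaw hindep hlaw hfm, charFun_map_sum_of_hasLaw hindep hlaw hfm,
      Finset.card_range]
  have hset : MeasurableSet {r : ℝ | ε ≤ |r / (I t).card - ∫ z, f z ∂P|} :=
    measurableSet_le measurable_const (by fun_prop)
  have e1 := Measure.map_apply_of_aemeasurable (hsum (Finset.range (I t).card)) hset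
  have e2 := Measure.map_apply_of_aemeasurable (hsum (I t)) hset
  rw [hlaweq, e2] at e1
  simp only [Function.comp_apply, Real.norm_eq_abs, hmean]
  exact e1.symm

/-- The characteristic function form of the one-dimensional central limit theorem, with an
arbitrary variance, including zero. -/
lemma tendsto_charFun_inv_sqrt_pow {P : Measure 𝓩} [IsProbabilityMeasure P] {X : 𝓩 → ℝ}
    (hX : AEMeasurable X P)
    (hX2 : Integrable (fun z => X z ^ 2) P) (h0 : ∫ z, X z ∂P = 0) :
    Tendsto (fun n : ℕ => charFun (P.map X) (√n)⁻¹ ^ n) atTop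
      (𝓝 (Complex.exp (-((∫ z, X z ^ 2 ∂P : ℝ) : ℂ) / 2))) := by
  set v := ∫ z, X z ^ 2 ∂P with hv
  have hv0 : 0 ≤ v := integral_nonneg fun z => sq_nonneg _
  rcases hv0.eq_or_lt with h | h
  -- a vanishing variance makes `X` vanish almost surely; otherwise rescale to variance one
  · have hz : ∀ᵐ z ∂P, X z = 0 := by
      have := (integral_eq_zero_iff_of_nonneg (fun z => sq_nonneg (X z)) hX2).1 h.symm
      filter_upwards [this] with z hz
      simpa using hz
    have : P.map X = Measure.dirac 0 := by
      rw [Measure.map_congr (g := fun _ => (0 : ℝ)) hz, Measure.map_const]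
      simp
    rw [this, ← h]
    simp [charFun_dirac]
  · have hσ : 0 < √v := Real.sqrt_pos.2 h
    have hσ2 : √v ^ 2 = v := Real.sq_sqrt hv0
    have key := tendsto_charFun_inv_sqrt_mul_pow (P := P) (X := fun z => (√v)⁻¹ * X z)
      (hX.const_mul _) (by rw [integral_const_mul, h0, mul_zero])
      (by
        simp only [Pi.pow_apply, mul_pow]
        rw [integral_const_mul, ← hv, inv_pow, hσ2, inv_mul_cancel₀ h.ne']) (√v)
    have e : Complex.exp (-(√v : ℂ) ^ 2 / 2) = Complex.exp (-(v : ℂ) / 2) := by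
      rw [← hσ2]; push_cast; rw [hσ2]
    rw [← e]
    refine key.congr fun n => ?_
    congr 1
    rw [charFun_map_mul_comp hX]
    congr 1
    field_simp

/-- The multivariate **central limit theorem** for centered i.i.d. vectors, over samples with
arbitrary finite index sets whose size tends to infinity. -/
lemma tendstoInDistribution_inv_sqrt_smul_sum {ι : Type*} [Fintype ι] [DecidableEq ι]
    [IsProbabilityMeasure P] (hindep : iIndepFun Z μ)
    (hlaw : ∀ i, HasLaw (Z i) P μ) {f : 𝓩 → EuclideanSpace ℝ ι} (hf : AEMeasurable f P)
    {S : Matrix ι ι ℝ} (hS : S.PosSemidef)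
    (hint : ∀ v, Integrable (fun z => (inner ℝ (f z) v : ℝ) ^ 2) P)
    (hmean : ∀ v, ∫ z, (inner ℝ (f z) v : ℝ) ∂P = 0)
    (hcov : ∀ v : EuclideanSpace ℝ ι,
      ∫ z, (inner ℝ (f z) v : ℝ) ^ 2 ∂P = v.ofLp ⬝ᵥ S.mulVec v.ofLp)
    {I : ℕ → Finset ℕ} (hI : Tendsto (fun t => (I t).card) atTop atTop) :
    TendstoInDistribution (fun t ω => (√((I t).card : ℝ))⁻¹ • ∑ i ∈ I t, f (Z i ω)) atTop
      (id : EuclideanSpace ℝ ι → _) (fun _ => μ) (multivariateGaussian 0 S) where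
  forall_aemeasurable t := by
    have := Finset.aemeasurable_fun_sum (I t) fun i _ => aemeasurable_comp_of_hasLaw hlaw hf i
    fun_prop
  aemeasurable_limit := aemeasurable_id
  tendsto := by
    refine ProbabilityMeasure.tendsto_iff_tendsto_charFun.2 fun v => ?_
    simp only [ProbabilityMeasure.coe_mk, Measure.map_id]
    rw [charFun_multivariateGaussian hS, inner_zero_right]
    have hfv : AEMeasurable (fun z => (inner ℝ (f z) v : ℝ)) P := by fun_prop
    have h1 := (tendsto_charFun_inv_sqrt_pow hfv (hint v) (hmean v)).comp hI
    rw [hcov v] at h1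
    have e : Complex.exp (((0 : ℝ) : ℂ) * Complex.I - ((v.ofLp ⬝ᵥ S.mulVec v.ofLp : ℝ) : ℂ) / 2) =
        Complex.exp (-((v.ofLp ⬝ᵥ S.mulVec v.ofLp : ℝ) : ℂ) / 2) := by
      congr 1; push_cast; ring
    rw [e]
    refine h1.congr fun t => ?_
    rw [charFun_map_smul_comp (Finset.aemeasurable_fun_sum _ fun i _ =>
      aemeasurable_comp_of_hasLaw hlaw hf i), charFun_map_sum_of_hasLaw hindep hlaw hf]
    simp only [Function.comp_apply]
    congr 1
    rw [charFun_apply, charFun_apply, integral_map hf (by fun_prop),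
      integral_map hfv (by fun_prop)]
    refine integral_congr_ae (Eventually.of_forall fun z => ?_)
    simp only [inner_smul_right]
    congr 2

end Sampling

/-- Convergence in distribution implies stochastic boundedness. -/
lemma boundedInProbability_of_tendstoInDistribution {p : ℕ} {Ω Ω' : Type*} [MeasurableSpace Ω]
    [MeasurableSpace Ω'] {μ : Measure Ω} [IsProbabilityMeasure μ] {μ' : Measure Ω'}
    [IsProbabilityMeasure μ'] {W : ℕ → Ω → EuclideanSpace ℝ (Fin p)}
    {V : Ω' → EuclideanSpace ℝ (Fin p)}
    (h : TendstoInDistribution W atTop V (fun _ => μ) μ') : BoundedInProbability μ W := by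
  intro ε hε
  have hV := h.aemeasurable_limit
  have hanti : Tendsto (fun n : ℕ => (μ'.map V) {x | (n : ℝ) ≤ ‖x‖}) atTop (𝓝 0) := by
    have : IsProbabilityMeasure (μ'.map V) := Measure.isProbabilityMeasure_map hV
    have hInter : ⋂ n : ℕ, {x : EuclideanSpace ℝ (Fin p) | (n : ℝ) ≤ ‖x‖} = ∅ := by
      ext x
      simp only [Set.mem_iInter, Set.mem_ofPred_eq, Set.mem_empty_iff_false, iff_false, not_forall,
        not_le]
      exact exists_nat_gt ‖x‖
    have := tendsto_measure_iInter_atTop (μ := μ'.map V)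
      (s := fun n : ℕ => {x : EuclideanSpace ℝ (Fin p) | (n : ℝ) ≤ ‖x‖})
      (fun n => (measurableSet_le measurable_const measurable_norm).nullMeasurableSet)
      (fun m n hmn => Set.ofPred_subset_ofPred.2 fun x hx => le_trans (Nat.cast_le.2 hmn) hx)
      ⟨0, measure_ne_top _ _⟩
    rwa [hInter, measure_empty] at this
  obtain ⟨n, hn⟩ := (hanti.eventually (gt_mem_nhds hε)).exists
  refine ⟨n, ?_⟩
  have hclosed : IsClosed {x : EuclideanSpace ℝ (Fin p) | (n : ℝ) ≤ ‖x‖} :=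
    isClosed_le continuous_const continuous_norm
  have hlim := ProbabilityMeasure.limsup_measure_closed_le_of_tendsto h.tendsto hclosed
  have := eventually_lt_of_limsup_lt (hlim.trans_lt hn)
  filter_upwards [this] with t ht
  rw [ProbabilityMeasure.coe_mk, Measure.map_apply_of_aemeasurable (h.forall_aemeasurable t)
    hclosed.measurableSet] at ht
  refine (measure_mono ?_).trans ht.le
  exact Set.ofPred_subset_ofPred.2 fun ω hω => le_of_lt hω

end AdaptiveLasso

/-! ### Population moments -/

namespace AdaptiveLasso

variable {p : ℕ} {L : ℝ → ℝ → ℝ} {P : Measure (ℝ × EuclideanSpace ℝ (Fin p))}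
  {b : EuclideanSpace ℝ (Fin p)}

lemma quadForm_phi (L : ℝ → ℝ → ℝ) (b : EuclideanSpace ℝ (Fin p))
    (z : ℝ × EuclideanSpace ℝ (Fin p)) (u : EuclideanSpace ℝ (Fin p)) :
    quadForm (Matrix.of fun k l => phiIntegrand L b k l z) u = (inner ℝ (score L b z) u) ^ 2 := by
  rw [score, real_inner_smul_left, inner_eq_sum z.2 u, mul_pow, sq (∑ k, _), Finset.sum_mul_sum,
    Finset.mul_sum, quadForm]
  refine Finset.sum_congr rfl fun k _ => ?_
  rw [Finset.mul_sum]
  refine Finset.sum_congr rfl fun l _ => ?_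
  simp only [phiIntegrand, Matrix.of_apply]
  ring

lemma integrable_quadForm {F : Fin p → Fin p → ℝ × EuclideanSpace ℝ (Fin p) → ℝ}
    (hF : ∀ k l, Integrable (F k l) P) (u : EuclideanSpace ℝ (Fin p)) :
    Integrable (fun z => quadForm (Matrix.of fun k l => F k l z) u) P := by
  simp only [quadForm, Matrix.of_apply]
  exact integrable_finsetSum _ fun k _ => integrable_finsetSum _ fun l _ => (hF k l).mul_const _

lemma integral_quadForm {F : Fin p → Fin p → ℝ × EuclideanSpace ℝ (Fin p) → ℝ}
    (hF : ∀ k l, Integrable (F k l) P) (u : EuclideanSpace ℝ (Fin p)) :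
    ∫ z, quadForm (Matrix.of fun k l => F k l z) u ∂P =
      quadForm (Matrix.of fun k l => ∫ z, F k l z ∂P) u := by
  simp only [quadForm, Matrix.of_apply]
  rw [integral_finsetSum _ fun k _ => integrable_finsetSum _ fun l _ => (hF k l).mul_const _]
  refine Finset.sum_congr rfl fun k _ => ?_
  rw [integral_finsetSum _ fun l _ => (hF k l).mul_const _]
  exact Finset.sum_congr rfl fun l _ => integral_mul_const _ _

lemma integrable_inner_score_sq (hΦ : ∀ k l, Integrable (phiIntegrand L b k l) P)
    (v : EuclideanSpace ℝ (Fin p)) :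
    Integrable (fun z => (inner ℝ (score L b z) v : ℝ) ^ 2) P := by
  simpa only [quadForm_phi] using integrable_quadForm hΦ v

lemma integral_inner_score_sq (hΦ : ∀ k l, Integrable (phiIntegrand L b k l) P)
    (v : EuclideanSpace ℝ (Fin p)) :
    ∫ z, (inner ℝ (score L b z) v : ℝ) ^ 2 ∂P = quadForm (Phi L P b) v := by
  have h := integral_quadForm hΦ v
  simp only [quadForm_phi] at h
  exact h

lemma integrable_inner_score [IsProbabilityMeasure P]
    (hLmeas : ∀ z, Measurable fun y => L y z) (hC1 : ConvexSmoothLoss L)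
    (hΦ : ∀ k l, Integrable (phiIntegrand L b k l) P) (v : EuclideanSpace ℝ (Fin p)) :
    Integrable (fun z => (inner ℝ (score L b z) v : ℝ)) P := by
  have hm : AEStronglyMeasurable (fun z => (inner ℝ (score L b z) v : ℝ)) P := by
    have := measurable_score (p := p) hLmeas hC1 b
    exact (by fun_prop : Measurable fun z => (inner ℝ (score L b z) v : ℝ)).aestronglyMeasurable
  exact ((memLp_two_iff_integrable_sq hm).2 (integrable_inner_score_sq hΦ v)).integrable
    one_le_two

lemma integrable_cubicEnvelope {g : EuclideanSpace ℝ (Fin p) → ℝ}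
    (hg : ∀ j k l : Fin p, Integrable (fun z => g z.2 * |z.2 j * z.2 k * z.2 l|) P) :
    Integrable (cubicEnvelope g) P :=
  integrable_finsetSum _ fun j _ => integrable_finsetSum _ fun k _ =>
    integrable_finsetSum _ fun l _ => hg j k l

/-- The first-order condition: the score has mean zero at the population minimizer. The expected
loss is only known to be finite at `b`, and the second-order expansion also gives its finiteness
nearby. -/
lemma integral_inner_score_eq_zero [IsProbabilityMeasure P]
    (hLmeas : ∀ z, Measurable fun y => L y z) (hC1 : ConvexSmoothLoss L)
    (hb : IsPopulationMinimizer L P b) {g : EuclideanSpace ℝ (Fin p) → ℝ} {ρ : ℝ} (hρ : 0 < ρ)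
    (hdom : ∀ᵐ z ∂P, ∀ b' ∈ Metric.ball b ρ,
      |iteratedDeriv 3 (L z.1) (inner ℝ z.2 b')| ≤ g z.2)
    (hg : ∀ j k l : Fin p, Integrable (fun z => g z.2 * |z.2 j * z.2 k * z.2 l|) P)
    (hΦ : ∀ k l, Integrable (phiIntegrand L b k l) P)
    (hΨ : ∀ k l, Integrable (psiIntegrand L b k l) P) (v : EuclideanSpace ℝ (Fin p)) :
    ∫ z, (inner ℝ (score L b z) v : ℝ) ∂P = 0 := by
  have hnonneg : ∀ v : EuclideanSpace ℝ (Fin p),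
      0 ≤ ∫ z, (inner ℝ (score L b z) v : ℝ) ∂P := by
    intro v
    set a := ∫ z, (inner ℝ (score L b z) v : ℝ) ∂P
    set q := quadForm (Psi L P b) v with hq
    set G := ∫ z, cubicEnvelope g z ∂P with hG
    have hcub := integrable_cubicEnvelope hg
    -- a directional difference quotient of the expected loss is nonnegative
    have hstep : ∀ τ : ℝ, 0 < τ → τ * ‖v‖ < ρ →
        0 ≤ a + τ * (q / 2) + τ ^ 2 * (G * ‖v‖ ^ 3 / 6) := by
      intro τ hτ hτρ
      have hn : ‖τ • v‖ = τ * ‖v‖ := by rw [norm_smul, Real.norm_eq_abs, abs_of_pos hτ]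
      have hexp : ∀ᵐ z ∂P, |L z.1 (inner ℝ z.2 (b + τ • v)) - L z.1 (inner ℝ z.2 b)
          - inner ℝ (score L b z) (τ • v)
          - quadForm (Matrix.of fun k l => psiIntegrand L b k l z) (τ • v) / 2|
          ≤ cubicEnvelope g z * ‖τ • v‖ ^ 3 / 6 := by
        filter_upwards [hdom] with z hz
        exact abs_loss_expansion_le hC1 hz (by rwa [hn])
      have hi1 : Integrable (fun z => cubicEnvelope g z * ‖τ • v‖ ^ 3 / 6) P :=
        (hcub.mul_const _).div_const _
      have hi2 : Integrable (fun z => (inner ℝ (score L b z) (τ • v) : ℝ)) P :=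
        integrable_inner_score hLmeas hC1 hΦ _
      have hi3 : Integrable (fun z =>
          quadForm (Matrix.of fun k l => psiIntegrand L b k l z) (τ • v) / 2) P :=
        (integrable_quadForm hΨ _).div_const _
      have hmeas : AEStronglyMeasurable (fun z => L z.1 (inner ℝ z.2 (b + τ • v))
          - L z.1 (inner ℝ z.2 b) - inner ℝ (score L b z) (τ • v)
          - quadForm (Matrix.of fun k l => psiIntegrand L b k l z) (τ • v) / 2) P :=
        ((((measurable_loss hLmeas hC1 _).sub
          (measurable_loss hLmeas hC1 _)).aestronglyMeasurable.sub hi2.aestronglyMeasurable).sub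
          hi3.aestronglyMeasurable)
      have hi4 := hi1.mono' hmeas (by simpa only [Real.norm_eq_abs] using hexp)
      have hi5 : Integrable (fun z => L z.1 (inner ℝ z.2 (b + τ • v))) P := by
        refine (((hi4.add hi3).add hi2).add hb.1).congr (Eventually.of_forall fun z => ?_)
        simp only [Pi.add_apply]
        ring
      have hmin := hb.2 _ hi5
      have hle : ∫ z, L z.1 (inner ℝ z.2 (b + τ • v)) ∂P ≤
          ∫ z, (L z.1 (inner ℝ z.2 b) + inner ℝ (score L b z) (τ • v)
            + quadForm (Matrix.of fun k l => psiIntegrand L b k l z) (τ • v) / 2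
            + cubicEnvelope g z * ‖τ • v‖ ^ 3 / 6) ∂P := by
        refine integral_mono_ae hi5 (((hb.1.add hi2).add hi3).add hi1) ?_
        filter_upwards [hexp] with z hz
        have := (abs_le.1 hz).2
        linarith
      rw [integral_add ((hb.1.fun_add hi2).fun_add hi3) hi1,
        integral_add (hb.1.fun_add hi2) hi3,
        integral_add hb.1 hi2, integral_div, integral_div, integral_mul_const,
        integral_quadForm hΨ] at hle
      have e1 : ∫ z, (inner ℝ (score L b z) (τ • v) : ℝ) ∂P = τ * a := by
        simp only [inner_smul_right]
        rw [integral_const_mul]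
      have e2 : quadForm (Matrix.of fun k l => ∫ z, psiIntegrand L b k l z ∂P) (τ • v) =
          τ ^ 2 * q := by
        rw [hq, quadForm, quadForm, Finset.mul_sum]
        refine Finset.sum_congr rfl fun k _ => ?_
        rw [Finset.mul_sum]
        refine Finset.sum_congr rfl fun l _ => ?_
        simp only [Psi, Matrix.of_apply, PiLp.smul_apply, smul_eq_mul]
        ring
      rw [e1, e2, hn, ← hG] at hle
      have h0 : 0 ≤ τ * (a + τ * (q / 2) + τ ^ 2 * (G * ‖v‖ ^ 3 / 6)) := by
        linarith [hle, hmin]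
      exact nonneg_of_mul_nonneg_right h0 hτ
    have hlim : Tendsto (fun τ : ℝ => a + τ * (q / 2) + τ ^ 2 * (G * ‖v‖ ^ 3 / 6))
        (𝓝[>] 0) (𝓝 a) := by
      have : Continuous fun τ : ℝ => a + τ * (q / 2) + τ ^ 2 * (G * ‖v‖ ^ 3 / 6) := by fun_prop
      simpa using (this.tendsto 0).mono_left nhdsWithin_le_nhds
    refine ge_of_tendsto hlim ?_
    have hsmall : ∀ᶠ τ : ℝ in 𝓝[>] 0, τ * ‖v‖ < ρ := by
      have : Tendsto (fun τ : ℝ => τ * ‖v‖) (𝓝[>] 0) (𝓝 0) := by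
        have hc : Continuous fun τ : ℝ => τ * ‖v‖ := by fun_prop
        simpa using (hc.tendsto 0).mono_left nhdsWithin_le_nhds
      exact this.eventually (gt_mem_nhds hρ)
    filter_upwards [hsmall, self_mem_nhdsWithin] with τ h1 h2
    exact hstep τ h2 h1
  refine le_antisymm ?_ (hnonneg v)
  have h := hnonneg (-v)
  simp only [inner_neg_right] at h
  rw [integral_neg] at h
  linarith

lemma isSymm_Psi (L : ℝ → ℝ → ℝ) (P : Measure (ℝ × EuclideanSpace ℝ (Fin p)))
    (b : EuclideanSpace ℝ (Fin p)) : (Psi L P b).IsSymm := by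
  ext k l
  simp only [Psi, Matrix.transpose_apply, Matrix.of_apply, psiIntegrand]
  exact integral_congr_ae (Eventually.of_forall fun z => by simp only; ring)

lemma isSymm_Phi (L : ℝ → ℝ → ℝ) (P : Measure (ℝ × EuclideanSpace ℝ (Fin p)))
    (b : EuclideanSpace ℝ (Fin p)) : (Phi L P b).IsSymm := by
  ext k l
  simp only [Phi, Matrix.transpose_apply, Matrix.of_apply, phiIntegrand]
  exact integral_congr_ae (Eventually.of_forall fun z => by simp only; ring)

lemma posSemidef_of_quadForm_nonneg {M : Matrix (Fin p) (Fin p) ℝ} (hM : M.IsSymm)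
    (h : ∀ u, 0 ≤ quadForm M u) : M.PosSemidef := by
  refine Matrix.PosSemidef.of_dotProduct_mulVec_nonneg ?_ fun x => ?_
  · rwa [Matrix.IsHermitian, Matrix.conjTranspose_eq_transpose_of_trivial]
  · have := h (WithLp.toLp 2 x)
    rw [quadForm_eq_inner, Matrix.inner_toEuclideanCLM] at this
    simpa using this

lemma posSemidef_Psi (hC1 : ConvexSmoothLoss L)
    (hΨ : ∀ k l, Integrable (psiIntegrand L b k l) P) : (Psi L P b).PosSemidef := by
  refine posSemidef_of_quadForm_nonneg (isSymm_Psi L P b) fun u => ?_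
  rw [Psi, ← integral_quadForm hΨ]
  refine integral_nonneg fun z => ?_
  simp only [quadForm_psi]
  exact mul_nonneg (iteratedDeriv_two_nonneg (hC1 z.1).1 (hC1 z.1).2.1 _) (sq_nonneg _)

lemma posSemidef_Phi (hΦ : ∀ k l, Integrable (phiIntegrand L b k l) P) :
    (Phi L P b).PosSemidef := by
  refine posSemidef_of_quadForm_nonneg (isSymm_Phi L P b) fun u => ?_
  rw [← integral_inner_score_sq hΦ]
  exact integral_nonneg fun z => sq_nonneg _

/-- Coercivity of `Ψ` on vectors supported on `A`. -/
lemma exists_coercive_Psi (hC1 : ConvexSmoothLoss L)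
    (hΨ : ∀ k l, Integrable (psiIntegrand L b k l) P) (A : Finset (Fin p))
    (hdet : IsUnit (submat A (Psi L P b)).det) :
    ∃ κ : ℝ, 0 < κ ∧ ∀ v, coordProj A v = v → κ * ‖v‖ ^ 2 ≤ quadForm (Psi L P b) v / 2 := by
  have hpos : (submat A (Psi L P b)).PosDef :=
    ((posSemidef_Psi hC1 hΨ).submatrix _).posDef_iff_isUnit.2
      ((Matrix.isUnit_iff_isUnit_det _).2 hdet)
  obtain ⟨κ, hκ, h⟩ := hpos.exists_forall_le_inner
  refine ⟨κ / 2, by positivity, fun v hv => ?_⟩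
  have := h (subvec A v)
  rw [norm_subvec_eq A hv] at this
  rw [quadForm_eq_of_supported A _ hv]
  linarith

/-- The influence function `-Ψ_A⁻¹ L'(y, xᵀb) x_A` of the estimator of the active
coefficients. -/
noncomputable def influence (L : ℝ → ℝ → ℝ) (P : Measure (ℝ × EuclideanSpace ℝ (Fin p)))
    (b : EuclideanSpace ℝ (Fin p)) (A : Finset (Fin p)) (z : ℝ × EuclideanSpace ℝ (Fin p)) :
    EuclideanSpace ℝ A :=
  -Matrix.toEuclideanCLM (𝕜 := ℝ) (submat A (Psi L P b))⁻¹ (subvec A (score L b z))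

lemma isSymm_inv_submat_Psi (A : Finset (Fin p)) : (submat A (Psi L P b))⁻¹.IsSymm :=
  ((isSymm_Psi L P b).submatrix _).inv

lemma inner_toEuclideanCLM_comm {ι : Type*} [Fintype ι] [DecidableEq ι] {M : Matrix ι ι ℝ}
    (hM : M.IsSymm) (u v : EuclideanSpace ℝ ι) :
    (inner ℝ (Matrix.toEuclideanCLM (𝕜 := ℝ) M u) v : ℝ) =
      inner ℝ u (Matrix.toEuclideanCLM (𝕜 := ℝ) M v) := by
  rw [real_inner_comm, Matrix.inner_toEuclideanCLM, Matrix.inner_toEuclideanCLM,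
    Matrix.dotProduct_mulVec, ← Matrix.mulVec_transpose, hM.eq, dotProduct_comm]

lemma inner_influence (A : Finset (Fin p)) (z : ℝ × EuclideanSpace ℝ (Fin p))
    (v : EuclideanSpace ℝ A) :
    (inner ℝ (influence L P b A z) v : ℝ) = inner ℝ (score L b z)
      (-embedVec A (Matrix.toEuclideanCLM (𝕜 := ℝ) (submat A (Psi L P b))⁻¹ v)) := by
  rw [influence, inner_neg_left, inner_toEuclideanCLM_comm (isSymm_inv_submat_Psi A),
    inner_neg_right, inner_eq_inner_subvec A _ (coordProj_embedVec A _), subvec_embedVec]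

lemma integral_inner_influence_sq (hΦ : ∀ k l, Integrable (phiIntegrand L b k l) P)
    (A : Finset (Fin p)) (v : EuclideanSpace ℝ A) :
    ∫ z, (inner ℝ (influence L P b A z) v : ℝ) ^ 2 ∂P = v.ofLp ⬝ᵥ
      ((submat A (Psi L P b))⁻¹ * submat A (Phi L P b) * (submat A (Psi L P b))⁻¹).mulVec
        v.ofLp := by
  simp only [inner_influence]
  rw [integral_inner_score_sq hΦ]
  set w := Matrix.toEuclideanCLM (𝕜 := ℝ) (submat A (Psi L P b))⁻¹ v with hw
  have h1 : quadForm (Phi L P b) (-embedVec A w) = quadForm (Phi L P b) (embedVec A w) := by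
    simp [quadForm]
  rw [h1, quadForm_eq_of_supported A _ (coordProj_embedVec A w), subvec_embedVec, hw,
    inner_toEuclideanCLM_comm (isSymm_inv_submat_Psi A), ← Matrix.inner_toEuclideanCLM]
  simp only [map_mul, ContinuousLinearMap.mul_def, ContinuousLinearMap.comp_apply]

lemma posSemidef_asymptoticCovariance (hΦ : ∀ k l, Integrable (phiIntegrand L b k l) P)
    (A : Finset (Fin p)) :
    ((submat A (Psi L P b))⁻¹ * submat A (Phi L P b) *
      (submat A (Psi L P b))⁻¹).PosSemidef := by
  have h := ((posSemidef_Phi hΦ).submatrix (fun k : A => (k : Fin p))).conjTranspose_mul_mul_same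
    (submat A (Psi L P b))⁻¹
  rwa [Matrix.conjTranspose_eq_transpose_of_trivial, (isSymm_inv_submat_Psi A).eq] at h

lemma subvec_quadMin_normScore (A : Finset (Fin p)) (I : Finset ℕ)
    (z : ℕ → ℝ × EuclideanSpace ℝ (Fin p)) :
    subvec A (quadMin A (Psi L P b) (normScore L b I z)) =
      (√(I.card : ℝ))⁻¹ • ∑ i ∈ I, influence L P b A (z i) := by
  rw [quadMin, subvec_embedVec, normScore, subvec_smul, map_smul, ← smul_neg]
  congr 1
  have : subvec A (∑ i ∈ I, score L b (z i)) = ∑ i ∈ I, subvec A (score L b (z i)) := by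
    ext k
    simp [subvec_apply, WithLp.ofLp_sum, Finset.sum_apply]
  rw [this, map_sum, ← Finset.sum_neg_distrib]
  rfl

end AdaptiveLasso

/-! ### Localization in probability -/

namespace AdaptiveLasso

variable {p : ℕ} {Ω : Type*} [MeasurableSpace Ω] {μ : Measure Ω} [IsProbabilityMeasure μ]
  {L : ℝ → ℝ → ℝ} {P : Measure (ℝ × EuclideanSpace ℝ (Fin p))}
  {Z : ℕ → Ω → ℝ × EuclideanSpace ℝ (Fin p)} {b : EuclideanSpace ℝ (Fin p)} {I : ℕ → Finset ℕ}

/-- The empirical Hessian at `b` converges to `Ψ` in probability. -/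
lemma tendsto_measure_hessianError (hindep : iIndepFun Z μ) (hlaw : ∀ i, HasLaw (Z i) P μ)
    (hΨ : ∀ k l, Integrable (psiIntegrand L b k l) P)
    (hI : Tendsto (fun t => (I t).card) atTop atTop) {c : ℝ} (hc : 0 < c) :
    Tendsto (fun t => μ {ω | c < hessianError L b (Psi L P b) (I t) (fun i => Z i ω)})
      atTop (𝓝 0) := by
  -- the added `1` covers `p = 0`
  set c' := c / ((p : ℝ) * p + 1) with hc'
  have hc'0 : 0 < c' := by positivity
  have h1 := fun k l => tendsto_measure_sampleMean_sub hindep hlaw (hΨ k l) hI hc'0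
  have h2 : Tendsto (fun t => ∑ k, ∑ l, μ {ω | c' ≤ |(∑ i ∈ I t, psiIntegrand L b k l (Z i ω)) /
      (I t).card - ∫ z, psiIntegrand L b k l z ∂P|}) atTop (𝓝 0) := by
    have := tendsto_finsetSum (Finset.univ : Finset (Fin p)) fun k _ =>
      tendsto_finsetSum (Finset.univ : Finset (Fin p)) fun l _ => h1 k l
    simpa using this
  refine tendsto_of_tendsto_of_tendsto_of_le_of_le tendsto_const_nhds h2 (fun _ => zero_le)
    fun t => ?_
  have hsub : {ω | c < hessianError L b (Psi L P b) (I t) (fun i => Z i ω)} ⊆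
      ⋃ k, ⋃ l, {ω | c' ≤ |(∑ i ∈ I t, psiIntegrand L b k l (Z i ω)) /
        (I t).card - ∫ z, psiIntegrand L b k l z ∂P|} := by
    intro ω hω
    by_contra hcon
    simp only [Set.mem_iUnion, Set.mem_ofPred_eq, not_exists, not_le] at hcon hω
    have h3 : hessianError L b (Psi L P b) (I t) (fun i => Z i ω) ≤
        ∑ _k : Fin p, ∑ _l : Fin p, c' :=
      Finset.sum_le_sum fun k _ => Finset.sum_le_sum fun l _ => (hcon k l).le
    simp only [Finset.sum_const, Finset.card_univ, Fintype.card_fin, nsmul_eq_mul] at h3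
    have h4 : (p : ℝ) * (p * c') ≤ c := by
      rw [hc', ← mul_assoc, ← mul_div_assoc, div_le_iff₀ (by positivity)]
      nlinarith
    linarith
  refine (measure_mono hsub).trans ((measure_iUnion_fintype_le _ _).trans ?_)
  exact Finset.sum_le_sum fun k _ => measure_iUnion_fintype_le _ _

variable [IsProbabilityMeasure P]

/-- The normalized score is bounded in probability. -/
lemma boundedInProbability_normScore (hLmeas : ∀ z, Measurable fun y => L y z)
    (hC1 : ConvexSmoothLoss L) (hindep : iIndepFun Z μ) (hlaw : ∀ i, HasLaw (Z i) P μ)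
    (hΦ : ∀ k l, Integrable (phiIntegrand L b k l) P)
    (hmean : ∀ v, ∫ z, (inner ℝ (score L b z) v : ℝ) ∂P = 0)
    (hI : Tendsto (fun t => (I t).card) atTop atTop) :
    BoundedInProbability μ fun t ω => normScore L b (I t) (fun i => Z i ω) := by
  refine boundedInProbability_of_tendstoInDistribution
    (tendstoInDistribution_inv_sqrt_smul_sum hindep hlaw
      (measurable_score hLmeas hC1 b).aemeasurable (posSemidef_Phi hΦ)
      (integrable_inner_score_sq hΦ) hmean (fun v => ?_) hI)
  rw [integral_inner_score_sq hΦ, quadForm_eq_inner, Matrix.inner_toEuclideanCLM]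

/-- With probability close to one, the adaptive lasso vanishes off the support of `b`, is
stochastically bounded in local coordinates, and is close to the minimizer of the limiting
quadratic. -/
lemma eventually_measure_not_localized_le (hLmeas : ∀ z, Measurable fun y => L y z)
    (hC1 : ConvexSmoothLoss L) (hindep : iIndepFun Z μ) (hlaw : ∀ i, HasLaw (Z i) P μ)
    {g : EuclideanSpace ℝ (Fin p) → ℝ} {ρ : ℝ} (hρ : 0 < ρ)
    (hdom : ∀ᵐ z ∂P, ∀ b' ∈ Metric.ball b ρ,
      |iteratedDeriv 3 (L z.1) (inner ℝ z.2 b')| ≤ g z.2)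
    (hg : ∀ j k l : Fin p, Integrable (fun z => g z.2 * |z.2 j * z.2 k * z.2 l|) P)
    (hΦ : ∀ k l, Integrable (phiIntegrand L b k l) P)
    (hmean : ∀ v, ∫ z, (inner ℝ (score L b z) v : ℝ) ∂P = 0)
    (hΨ : ∀ k l, Integrable (psiIntegrand L b k l) P)
    (hΨA : IsUnit (submat (supp b) (Psi L P b)).det)
    (hI : Tendsto (fun t => (I t).card) atTop atTop) {ξ : ℝ} (hξ : 0 < ξ)
    {pre : ℕ → Ω → EuclideanSpace ℝ (Fin p)}
    (hpre : BoundedInProbability μ fun t ω => √((I t).card : ℝ) • (pre t ω - b))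
    {lam : ℕ → ℝ} (hlam_nonneg : ∀ t, 0 ≤ lam t)
    (hlam_small : Tendsto (fun t => lam t / √((I t).card : ℝ)) atTop (𝓝 0))
    (hlam_large : Tendsto (fun t => lam t * ((I t).card : ℝ) ^ ((ξ - 1) / 2)) atTop atTop)
    {bhat : ℕ → Ω → EuclideanSpace ℝ (Fin p)}
    (hbhat : Tendsto (fun t => μ {ω | ¬ IsAdaptiveLasso L (I t)
      (fun i => (Z i ω).1) (fun i => (Z i ω).2) (lam t) ξ (pre t ω) (bhat t ω)}) atTop (𝓝 0))
    {ε : ℝ} (hε : 0 < ε) (hε1 : ε ≤ 1) {η : ℝ≥0∞} (hη : 0 < η) :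
    ∃ R : ℝ, ∀ᶠ t in atTop, μ {ω | ¬ (
      ‖√((I t).card : ℝ) • (bhat t ω - b) - quadMin (supp b) (Psi L P b)
        (normScore L b (I t) (fun i => Z i ω))‖ < ε ∧
      coordProj (supp b) (√((I t).card : ℝ) • (bhat t ω - b)) =
        √((I t).card : ℝ) • (bhat t ω - b) ∧
      ‖√((I t).card : ℝ) • (bhat t ω - b)‖ ≤ R)} ≤ η := by
  set A := supp b with hA
  have hbA : ∀ k ∉ A, b k = 0 := fun k hk => by simpa [hA, supp] using hk
  have hbA' : ∀ k ∈ A, b k ≠ 0 := fun k hk => by simpa [hA, supp] using hk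
  have hη' : 0 < η / 5 := ENNReal.div_pos hη.ne' (by simp)
  obtain ⟨κ, hκ, hcoer⟩ := exists_coercive_Psi hC1 hΨ A hΨA
  obtain ⟨R₁, hR₁⟩ := boundedInProbability_normScore hLmeas hC1 hindep hlaw hΦ hmean hI _ hη'
  obtain ⟨M₁, hM₁⟩ := hpre _ hη'
  -- the constants of the deterministic argument
  set R₀ := max R₁ 0
  set Mp := max M₁ 1
  set K := ‖Matrix.toEuclideanCLM (𝕜 := ℝ) (submat A (Psi L P b))⁻¹‖
  set R := K * R₀ + 1 with hR
  set δ := min (κ * ε ^ 2 / 8) (ε / 4) with hδ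
  set C := 2 * (R₀ * (R + 1) + (∑ k, ∑ l, |Psi L P b k l|) * (R + 1) ^ 2 / 2 + δ) + 1
  set G := |∫ z, cubicEnvelope g z ∂P| + 1
  set B := ∑ k ∈ A, ((|b k| / 2) ^ ξ)⁻¹
  have hR₀ : 0 ≤ R₀ := le_max_right _ _
  have hMp : 0 < Mp := lt_of_lt_of_le one_pos (le_max_right _ _)
  have hR1 : 0 < R := by positivity
  have hδ0 : 0 < δ := by positivity
  have hδ1 : δ < κ * ε ^ 2 / 4 := lt_of_le_of_lt (min_le_left _ _) (by
    have : 0 < κ * ε ^ 2 := by positivity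
    linarith)
  have hδ2 : δ < ε / 2 := lt_of_le_of_lt (min_le_right _ _) (by linarith)
  have hG0 : 0 ≤ G := by positivity
  have hB0 : 0 ≤ B := Finset.sum_nonneg fun k _ => by positivity
  -- the conditions on the sample size and the tuning parameter hold for large `t`
  have hs : Tendsto (fun t => √((I t).card : ℝ)) atTop atTop :=
    Real.tendsto_sqrt_atTop.comp (tendsto_natCast_atTop_atTop.comp hI)
  have hdiv : ∀ a : ℝ, Tendsto (fun t => a / √((I t).card : ℝ)) atTop (𝓝 0) := fun a =>
    hs.const_div_atTop a
  have e1 : ∀ᶠ t in atTop, 0 < (I t).card := hI.eventually_gt_atTop 0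
  have e2 : ∀ᶠ t in atTop, (R + 1) / √((I t).card : ℝ) < ρ :=
    (hdiv _).eventually (gt_mem_nhds hρ)
  have e3 : ∀ᶠ t in atTop, G * (R + 1) ^ 3 / 6 / √((I t).card : ℝ) < δ / 8 :=
    (hdiv _).eventually (gt_mem_nhds (by positivity))
  have e4 : ∀ᶠ t in atTop, lam t / √((I t).card : ℝ) * (A.card * B) * (2 * R) < δ / 2 := by
    have := (hlam_small.mul_const (A.card * B)).mul_const (2 * R)
    rw [zero_mul, zero_mul] at this
    exact this.eventually (gt_mem_nhds (by positivity))
  have e5 : ∀ᶠ t in atTop, C * Mp ^ ξ + 1 ≤ lam t * ((I t).card : ℝ) ^ ((ξ - 1) / 2) :=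
    hlam_large.eventually_ge_atTop _
  have e6 : ∀ᶠ t in atTop, ∀ k ∈ A, Mp / √((I t).card : ℝ) < |b k| / 2 := by
    rw [eventually_all_finset]
    intro k hk
    exact (hdiv _).eventually (gt_mem_nhds (by have := hbA' k hk; positivity))
  -- the exceptional events
  have E1 := hbhat.eventually (gt_mem_nhds hη')
  have E4 := (tendsto_measure_hessianError hindep hlaw hΨ hI
    (c := δ / (4 * (R + 1) ^ 2)) (by positivity)).eventually (gt_mem_nhds hη')
  have E5 := (tendsto_measure_sampleMean_sub hindep hlaw (integrable_cubicEnvelope hg) hI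
    one_pos).eventually (gt_mem_nhds hη')
  have hnull : ∀ᵐ ω ∂μ, ∀ i, ∀ b' ∈ Metric.ball b ρ,
      |iteratedDeriv 3 (L (Z i ω).1) (inner ℝ (Z i ω).2 b')| ≤ g (Z i ω).2 := by
    rw [ae_all_iff]
    intro i
    exact ae_of_ae_map (hlaw i).aemeasurable (by rw [(hlaw i).map_eq]; exact hdom)
  refine ⟨R, ?_⟩
  filter_upwards [e1, e2, e3, e4, e5, e6, E1, hM₁, hR₁, E4, E5] with t e1 e2 e3 e4 e5 e6 E1 E2 E3
    E4 E5
  have hs0 : 0 < √((I t).card : ℝ) := Real.sqrt_pos.2 (by exact_mod_cast e1)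
  have hrpow : ((I t).card : ℝ) ^ ((ξ - 1) / 2) = √((I t).card : ℝ) ^ (ξ - 1) := by
    rw [Real.sqrt_eq_rpow, ← Real.rpow_mul (by positivity)]
    congr 1; ring
  have hC0 : 0 ≤ C * Mp ^ ξ := by positivity
  have hlam : 0 < lam t := by
    refine (hlam_nonneg t).lt_of_ne fun h => ?_
    rw [← h, zero_mul] at e5
    linarith
  set N₁ := {ω | ¬ IsAdaptiveLasso L (I t)
      (fun i => (Z i ω).1) (fun i => (Z i ω).2) (lam t) ξ (pre t ω) (bhat t ω)} with hN₁
  set N₂ := {ω | M₁ < ‖√((I t).card : ℝ) • (pre t ω - b)‖} with hN₂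
  set N₃ := {ω | R₁ < ‖normScore L b (I t) (fun i => Z i ω)‖} with hN₃
  set N₄ := {ω | δ / (4 * (R + 1) ^ 2) <
    hessianError L b (Psi L P b) (I t) (fun i => Z i ω)} with hN₄
  set N₅ := {ω | 1 ≤ |(∑ i ∈ I t, cubicEnvelope g (Z i ω)) / (I t).card -
    ∫ z, cubicEnvelope g z ∂P|} with hN₅
  set N₆ := {ω | ¬ ∀ i, ∀ b' ∈ Metric.ball b ρ,
      |iteratedDeriv 3 (L (Z i ω).1) (inner ℝ (Z i ω).2 b')| ≤ g (Z i ω).2} with hN₆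
  have hN₆0 : μ N₆ = 0 := hnull
  have hsub : {ω | ¬ (
      ‖√((I t).card : ℝ) • (bhat t ω - b) - quadMin A (Psi L P b)
        (normScore L b (I t) (fun i => Z i ω))‖ < ε ∧
      coordProj A (√((I t).card : ℝ) • (bhat t ω - b)) =
        √((I t).card : ℝ) • (bhat t ω - b) ∧
      ‖√((I t).card : ℝ) • (bhat t ω - b)‖ ≤ R)} ⊆ N₁ ∪ N₂ ∪ N₃ ∪ N₄ ∪ N₅ ∪ N₆ := by
    intro ω hω
    by_contra hcon
    simp only [Set.mem_union, hN₁, hN₂, hN₃, hN₄, hN₅, hN₆, Set.mem_ofPred_eq, not_or, not_not,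
      not_lt, not_le] at hcon
    obtain ⟨⟨⟨⟨⟨h1, h2⟩, h3⟩, h4⟩, h5⟩, h6⟩ := hcon
    rw [Set.mem_ofPred_eq] at hω
    have h2' := h2.trans (le_max_left M₁ 1)
    have h3' := h3.trans (le_max_left R₁ 0)
    -- the pre-estimate stays away from zero on the support
    have hpk : ∀ k ∈ A, |b k| / 2 ≤ |pre t ω k| := by
      intro k hk
      have hk1 := (abs_apply_le_norm (√((I t).card : ℝ) • (pre t ω - b)) k).trans h2'
      rw [PiLp.smul_apply, PiLp.sub_apply, smul_eq_mul, abs_mul, abs_of_pos hs0, mul_comm,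
        ← le_div_iff₀ hs0] at hk1
      have hk2 := e6 k hk
      have hk3 := abs_sub_abs_le_abs_sub (b k) (pre t ω k)
      rw [abs_sub_comm] at hk3
      linarith
    have hbk : ∀ k ∈ A, 0 < |b k| / 2 := fun k hk => by have := hbA' k hk; positivity
    obtain ⟨hloc, hsupp⟩ := localization_of_good_sample hC1 e1 (z := fun i => Z i ω)
      (fun i _ => h6 i) (isSymm_Psi L P b) A hΨA hbA hκ hcoer (R₀ := R₀) (R := R) (C := C)
      (G := G) (B := B) (Mp := Mp) hε hε1 hδ0 hδ1 hδ2 le_rfl le_rfl e2 h3'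
      (by
        rw [le_div_iff₀ (by positivity)] at h4
        linarith)
      (by
        have := (abs_lt.1 h5).2
        have h7 := le_abs_self (∫ z, cubicEnvelope g z ∂P)
        simp only [sampleMean]
        linarith)
      hG0 (by rw [← div_div]; exact e3.le) hlam hξ hMp h2'
      (fun k hk => abs_pos.1 ((hbk k hk).trans_le (hpk k hk)))
      (fun k hk => by
        have h8 : (|pre t ω k| ^ ξ)⁻¹ ≤ ((|b k| / 2) ^ ξ)⁻¹ :=
          inv_anti₀ (Real.rpow_pos_of_pos (hbk k hk) _)
            (Real.rpow_le_rpow (hbk k hk).le (hpk k hk) hξ.le)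
        refine h8.trans (Finset.single_le_sum (f := fun k => ((|b k| / 2) ^ ξ)⁻¹)
          (fun k _ => by positivity) hk))
      hB0 e4.le (by rw [← hrpow]; linarith) h1
    refine hω ⟨hloc, hsupp, ?_⟩
    have h9 := norm_quadMin_le A (Psi L P b) (normScore L b (I t) (fun i => Z i ω))
    have h10 : K * ‖normScore L b (I t) (fun i => Z i ω)‖ ≤ K * R₀ := by gcongr
    have h11 := norm_le_norm_add_norm_sub' (√((I t).card : ℝ) • (bhat t ω - b))
      (quadMin A (Psi L P b) (normScore L b (I t) (fun i => Z i ω)))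
    linarith
  refine (measure_mono hsub).trans ?_
  calc μ (N₁ ∪ N₂ ∪ N₃ ∪ N₄ ∪ N₅ ∪ N₆) ≤ μ N₁ + μ N₂ + μ N₃ + μ N₄ + μ N₅ + μ N₆ := by
        refine (measure_union_le _ _).trans (add_le_add ?_ le_rfl)
        refine (measure_union_le _ _).trans (add_le_add ?_ le_rfl)
        refine (measure_union_le _ _).trans (add_le_add ?_ le_rfl)
        refine (measure_union_le _ _).trans (add_le_add ?_ le_rfl)
        exact measure_union_le _ _
    _ ≤ η / 5 + η / 5 + η / 5 + η / 5 + η / 5 + 0 :=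
        add_le_add (add_le_add (add_le_add (add_le_add (add_le_add E1.le E2) E3) E4.le) E5.le)
          hN₆0.le
    _ = 5 * (η / 5) := by ring
    _ = η := ENNReal.mul_div_cancel (by norm_num) (by norm_num)

end AdaptiveLasso

/-! ### Selection consistency and asymptotic normality -/

theorem theorem1 {p : ℕ} {Ω : Type*} [MeasurableSpace Ω] (μ : Measure Ω) [IsProbabilityMeasure μ]
    -- the loss: measurable in the response, convex and smooth in its second argument
    (L : ℝ → ℝ → ℝ) (hLmeas : ∀ z, Measurable fun y => L y z)
    (hC1 : AdaptiveLasso.ConvexSmoothLoss L)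
    -- the joint law of `(Y, X)` and the i.i.d. samples from it
    (P : Measure (ℝ × EuclideanSpace ℝ (Fin p)))
    (Y : ℕ → Ω → ℝ) (X : ℕ → Ω → EuclideanSpace ℝ (Fin p))
    (hindep : iIndepFun (fun i ω => (Y i ω, X i ω)) μ)
    (hlaw : ∀ i, HasLaw (fun ω => (Y i ω, X i ω)) P μ)
    -- the true parameter, and the standing assumptions on the population
    (βstar : EuclideanSpace ℝ (Fin p))
    (hβstar : AdaptiveLasso.IsPopulationMinimizer L P βstar)
    (hC2 : AdaptiveLasso.ThirdDerivDominated L P βstar)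
    (hΦ : ∀ k l, Integrable (AdaptiveLasso.phiIntegrand L βstar k l) P)
    (hΨ : ∀ k l, Integrable (AdaptiveLasso.psiIntegrand L βstar k l) P)
    (hΨA : IsUnit (AdaptiveLasso.submat (AdaptiveLasso.supp βstar)
      (AdaptiveLasso.Psi L P βstar)).det)
    -- the samples stored in the worker at stage `t`; their number tends to infinity
    (I : ℕ → Finset ℕ) (hI : Tendsto (fun t => (I t).card) atTop atTop)
    -- the root-n-consistent pre-estimate that defines the adaptive weights
    (ξ : ℝ) (hξ : 0 < ξ)
    (pre : ℕ → Ω → EuclideanSpace ℝ (Fin p)) (hpre_meas : ∀ t, AEMeasurable (pre t) μ)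
    (hpre : AdaptiveLasso.BoundedInProbability μ
      fun t ω => √((I t).card : ℝ) • (pre t ω - βstar))
    -- the tuning parameter
    (lam : ℕ → ℝ) (hlam_nonneg : ∀ t, 0 ≤ lam t)
    (hlam_small : Tendsto (fun t => lam t / √((I t).card : ℝ)) atTop (𝓝 0))
    (hlam_large : Tendsto (fun t => lam t * ((I t).card : ℝ) ^ ((ξ - 1) / 2)) atTop atTop)
    -- the local adaptive lasso estimator, a minimizer with probability tending to one
    (βhat : ℕ → Ω → EuclideanSpace ℝ (Fin p)) (hβhat_meas : ∀ t, AEMeasurable (βhat t) μ)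
    (hβhat : Tendsto (fun t => μ {ω | ¬ AdaptiveLasso.IsAdaptiveLasso L (I t)
      (fun i => Y i ω) (fun i => X i ω) (lam t) ξ (pre t ω) (βhat t ω)}) atTop (𝓝 0)) :
    -- selection consistency
    Tendsto (fun t => μ {ω | AdaptiveLasso.supp (βhat t ω) = AdaptiveLasso.supp βstar})
      atTop (𝓝 1) ∧
    -- asymptotic normality on the true support
    TendstoInDistribution
      (fun t ω => √((I t).card : ℝ) •
        (AdaptiveLasso.subvec (AdaptiveLasso.supp βstar) (βhat t ω) -
          AdaptiveLasso.subvec (AdaptiveLasso.supp βstar) βstar))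
      atTop (id : EuclideanSpace ℝ (AdaptiveLasso.supp βstar) → _) (fun _ => μ)
      (multivariateGaussian 0
        ((AdaptiveLasso.submat (AdaptiveLasso.supp βstar) (AdaptiveLasso.Psi L P βstar))⁻¹ *
          AdaptiveLasso.submat (AdaptiveLasso.supp βstar) (AdaptiveLasso.Phi L P βstar) *
          (AdaptiveLasso.submat (AdaptiveLasso.supp βstar) (AdaptiveLasso.Psi L P βstar))⁻¹)) := by
  have hP : IsProbabilityMeasure P := by
    rw [← (hlaw 0).map_eq]
    exact Measure.isProbabilityMeasure_map (hlaw 0).aemeasurable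
  obtain ⟨O, g, hO, hbO, hdomO, hg⟩ := hC2
  obtain ⟨ρ, hρ, hball⟩ := Metric.isOpen_iff.1 hO _ hbO
  have hdom : ∀ᵐ z ∂P, ∀ b' ∈ Metric.ball βstar ρ,
      |iteratedDeriv 3 (L z.1) (inner ℝ z.2 b')| ≤ g z.2 := by
    filter_upwards [hdomO] with z hz b' hb' using hz b' (hball hb')
  have hmean := AdaptiveLasso.integral_inner_score_eq_zero hLmeas hC1 hβstar hρ hdom hg hΦ hΨ
  have hloc := fun {ε : ℝ} (hε : 0 < ε) (hε1 : ε ≤ 1) {η : ℝ≥0∞} (hη : 0 < η) =>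
    AdaptiveLasso.eventually_measure_not_localized_le hLmeas hC1 hindep hlaw hρ hdom hg hΦ hmean
      hΨ hΨA hI hξ hpre hlam_nonneg hlam_small hlam_large hβhat hε hε1 hη
  set A := AdaptiveLasso.supp βstar with hA
  have hs : Tendsto (fun t => √((I t).card : ℝ)) atTop atTop :=
    Real.tendsto_sqrt_atTop.comp (tendsto_natCast_atTop_atTop.comp hI)
  constructor
  · have hbad : Tendsto (fun t => μ {ω | ¬ AdaptiveLasso.supp (βhat t ω) = A}) atTop (𝓝 0) := by
      rw [ENNReal.tendsto_nhds_zero]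
      intro η hη
      obtain ⟨R, hR⟩ := hloc one_pos le_rfl hη
      have hlarge : ∀ᶠ t in atTop, ∀ k ∈ A, R < √((I t).card : ℝ) * |βstar k| := by
        rw [Filter.eventually_all_finset]
        intro k hk
        have hk0 : 0 < |βstar k| := abs_pos.2 (by simpa [hA, AdaptiveLasso.supp] using hk)
        exact (hs.atTop_mul_const hk0).eventually_gt_atTop R
      filter_upwards [hR, hlarge, hs.eventually_gt_atTop 0] with t hRt hlt hst
      refine (measure_mono (Set.ofPred_subset_ofPred.2 fun ω hω hgood => hω ?_)).trans hRt
      obtain ⟨-, hsupp, hbound⟩ := hgood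
      rw [AdaptiveLasso.coordProj_eq_self_iff] at hsupp
      ext k
      by_cases hk : k ∈ A
      · simp only [hk, iff_true]
        simp only [AdaptiveLasso.supp, Finset.mem_filter, Finset.mem_univ, true_and]
        -- a vanishing estimate of a nonzero coefficient is unbounded in local coordinates
        intro h0
        have h1 := (AdaptiveLasso.abs_apply_le_norm
          (√((I t).card : ℝ) • (βhat t ω - βstar)) k).trans hbound
        rw [PiLp.smul_apply, PiLp.sub_apply, h0, zero_sub, smul_eq_mul, mul_neg, abs_neg, abs_mul,
          abs_of_pos hst] at h1
        exact absurd (hlt k hk) (not_lt.2 h1)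
      · simp only [hk, iff_false]
        have h1 := hsupp k hk
        have h2 : βstar k = 0 := by simpa [hA, AdaptiveLasso.supp] using hk
        rw [PiLp.smul_apply, PiLp.sub_apply, h2, sub_zero, smul_eq_mul] at h1
        simpa [AdaptiveLasso.supp] using (mul_eq_zero.1 h1).resolve_left hst.ne'
    have hlow : Tendsto (fun t => 1 - μ {ω | ¬ AdaptiveLasso.supp (βhat t ω) = A}) atTop
        (𝓝 1) := by
      have := ENNReal.Tendsto.sub (tendsto_const_nhds (x := (1 : ℝ≥0∞))) hbad (by simp)
      rwa [tsub_zero] at this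
    refine tendsto_of_tendsto_of_tendsto_of_le_of_le hlow tendsto_const_nhds (fun t => ?_)
      fun t => prob_le_one
    -- by subadditivity, so that measurability of the selection event is not needed
    rw [tsub_le_iff_right, ← measure_univ (μ := μ)]
    refine (measure_mono fun ω _ => ?_).trans (measure_union_le _ _)
    exact em (AdaptiveLasso.supp (βhat t ω) = A)
  · have hinf : Measurable (AdaptiveLasso.influence L P βstar A) := by
      have h1 := AdaptiveLasso.measurable_score hLmeas hC1 βstar
      have h2 := (AdaptiveLasso.continuous_subvec A).measurable
      unfold AdaptiveLasso.influence
      fun_prop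
    have hclt := AdaptiveLasso.tendstoInDistribution_inv_sqrt_smul_sum hindep hlaw
      hinf.aemeasurable (AdaptiveLasso.posSemidef_asymptoticCovariance hΦ A)
      (fun v => by
        simp only [AdaptiveLasso.inner_influence]
        exact AdaptiveLasso.integrable_inner_score_sq hΦ _)
      (fun v => by simp only [AdaptiveLasso.inner_influence, hmean])
      (AdaptiveLasso.integral_inner_influence_sq hΦ A) hI
    refine tendstoInDistribution_of_tendstoInMeasure_sub _ _ hclt ?_ fun t => ?_
    · rw [tendstoInMeasure_iff_norm]
      intro ε hε
      rw [ENNReal.tendsto_nhds_zero]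
      intro η hη
      obtain ⟨R, hR⟩ := hloc (lt_min hε one_pos) (min_le_right ε 1) hη
      filter_upwards [hR] with t hRt
      refine (measure_mono (Set.ofPred_subset_ofPred.2 fun ω hω hgood => ?_)).trans hRt
      have h1 := hgood.1.trans_le (min_le_left _ _)
      simp only [Pi.sub_apply, Pi.zero_apply, sub_zero] at hω
      rw [← AdaptiveLasso.subvec_quadMin_normScore, ← AdaptiveLasso.subvec_sub,
        ← AdaptiveLasso.subvec_smul, ← AdaptiveLasso.subvec_sub] at hω
      exact absurd (hω.trans (AdaptiveLasso.norm_subvec_le A _)) (not_le.2 h1)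
    · have h1 := (AdaptiveLasso.continuous_subvec A).measurable.comp_aemeasurable (hβhat_meas t)
      exact (h1.sub_const _).fun_const_smul _
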